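/- Conventions. Let $(X,\rho)$ be a pseudometric space. A Lipschitz curve fragment in $X$ is a Lipschitz map $\gamma\colon K\to X$ with $K\subset\mathbb{R}$ compact. A Lipschitz function $f\colon X\to\mathbb{R}$ is curve-flat if $\mathcal{H}^1(f(\gamma(K)))=0$ for every Lipschitz curve fragment $\gamma\colon K\to X$. Put $$\rho_{cf}(p,q)=\sup\{|f(p)-f(q)| : f\colon X\to\mathbb{R}\text{ is } 1\text{-Lipschitz and curve-flat}\},$$ $\rho_{cf}^0=\rho$, $\rho_{cf}^{\beta+1}=(\rho_{cf}^\beta)_{cf}$, and $\rho_{cf}^\beta=\inf_{\gamma<\beta}\rho_{cf}^\gamma$ for limit ordinals $\beta$. The curve-flat quotient $X_{cf}^\beta$ is the metric space obtained from $(X,\rho_{cf}^\beta)$ by identifying points at distance $0$. A metric space is purely $1$-unrectifiable if the image of each of its Lipschitz curve fragments is $\mathcal{H}^1$-null, and the curve-flat index $\alpha_{cf}(X)$ is the least countable ordinal $\beta$ such that $X_{cf}^\beta$ is purely $1$-unrectifiable. A subset $S\subset X$ is total for $\rho$ if every point of $X$ is at $\rho$-distance $0$ from some point of $S$. A $(1+\varepsilon)$-isometry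 is a bijection $\varphi$ between metric spaces such that the distance of $\varphi(p),\varphi(q)$ lies between $1-\varepsilon$ and $1+\varepsilon$ times the distance of $p,q$, for all $p,q$. A metric space is geodesic if any two distinct points are joined by a curve whose length is their distance. A gapped segment is a metric space isometric to $[0,\frac{\omega(a)-a}{2}]\cup[\frac{\omega(a)+a}{2},\omega(a)]\subset\mathbb{R}$, where $a>0$ and $\omega\colon[0,\infty)\to[0,\infty)$ is a concave function with $\omega(0)=0$ and $\omega(a)\ge a$. Theorem. Let $(M,d)$ be a compact metric space with at least two points, let $\alpha$ be a countable ordinal and let $\varepsilon>0$. Then the index $\alpha_{cf}(M)$ exists, and there are a compact metric space $(Y,\rho)$, whose curve-flat index exists and equals $$\alpha_{cf}(Y)=\alpha+\alpha_{cf}(M)$$ (ordinal sum, in this order), and an injective map $\iota\colon M\to Y$ such that the following hold. 1. $\operatorname{diam}(Y,\rho)<3\operatorname{diam}(M,d)$. 2. $\iota(M)$ is total for $\rho_{cf}^\alpha$, and $d(x,y)\le\rho_{cf}^\alpha(\iota(x),\iota(y))\le(1+\varepsilon)\,d(x,y)$ for all $x,y\in M$; in particular $\iota$ induces a $(1+\varepsilon)$-isometry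 of $(M,d)$ onto $(Y_{cf}^\alpha,\rho_{cf}^\alpha)$. Moreover, $\rho(\iota(x),\iota(y))=d(x,y)$ whenever $x,y\in M$ satisfy $d(x,y)=\operatorname{diam}(M,d)$. 3. If $M$ is a geodesic space, a gapped segment, or finite, then $\rho_{cf}^\alpha(\iota(x),\iota(y))=d(x,y)$ for all $x,y\in M$. -/

import Mathlib

open MeasureTheory Set
open scoped NNReal

universe u

noncomputable section

/-! ## Curve-flat functions and curve-flat pseudometrics

Pseudometrics are handled here as plain functions `ρ : X → X → ℝ`, because the successive
curve-flat pseudometrics all live on the same set. -/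

section Raw

variable {X : Type u}

/-- `ρ` is a pseudometric on `X`. -/
structure IsPseudoDist (ρ : X → X → ℝ) : Prop where
  self : ∀ x, ρ x x = 0
  symm : ∀ x y, ρ x y = ρ y x
  triangle : ∀ x y z, ρ x z ≤ ρ x y + ρ y z

theorem IsPseudoDist.nonneg {ρ : X → X → ℝ} (h : IsPseudoDist ρ) (x y : X) : 0 ≤ ρ x y := by
  have h1 := h.triangle x y x
  rw [h.self, h.symm y x] at h1
  linarith

/-- `γ`, restricted to the compact set `K ⊆ ℝ`, is a Lipschitz curve fragment in `(X, ρ)`. -/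
def IsLipCurveFragment (ρ : X → X → ℝ) (K : Set ℝ) (γ : ℝ → X) : Prop :=
  IsCompact K ∧ ∃ L : ℝ, ∀ s ∈ K, ∀ t ∈ K, ρ (γ s) (γ t) ≤ L * |s - t|

/-- A real function `f` on `(X, ρ)` is curve-flat if it is Lipschitz and the image under `f` of
every Lipschitz curve fragment is null for the one-dimensional Hausdorff measure. -/
def IsCurveFlat (ρ : X → X → ℝ) (f : X → ℝ) : Prop :=
  (∃ C : ℝ, ∀ x y, |f x - f y| ≤ C * ρ x y) ∧
    ∀ (K : Set ℝ) (γ : ℝ → X), IsLipCurveFragment ρ K γ →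
      Measure.hausdorffMeasure (X := ℝ) 1 ((fun t => f (γ t)) '' K) = 0

/-- The curve-flat pseudometric `ρ_cf`: the supremum of `|f p - f q|` over all functions `f` that
are `1`-Lipschitz and curve-flat for `ρ`. -/
def curveFlatDist (ρ : X → X → ℝ) (p q : X) : ℝ :=
  sSup {r : ℝ | ∃ f : X → ℝ, (∀ x y, |f x - f y| ≤ ρ x y) ∧ IsCurveFlat ρ f ∧ r = |f p - f q|}

/-- The curve-flat pseudometric `ρ_cf^α` of order `α`, by transfinite recursion:
`ρ_cf^0 = ρ`, `ρ_cf^(α+1) = (ρ_cf^α)_cf`, and the infimum of the previous ones at limits. -/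
def iterCurveFlatDist (ρ : X → X → ℝ) (α : Ordinal.{0}) : X → X → ℝ :=
  Ordinal.limitRecOn (motive := fun _ => X → X → ℝ) α ρ
    (fun _ σ => curveFlatDist σ)
    (fun β _ σ x y => ⨅ γ : Set.Iio β, σ γ.1 γ.2 x y)

theorem iterCurveFlatDist_zero (ρ : X → X → ℝ) : iterCurveFlatDist ρ 0 = ρ :=
  Ordinal.limitRecOn_zero _ _ _

theorem iterCurveFlatDist_add_one (ρ : X → X → ℝ) (α : Ordinal.{0}) :
    iterCurveFlatDist ρ (α + 1) = curveFlatDist (iterCurveFlatDist ρ α) :=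
  Ordinal.limitRecOn_add_one _ _ _ _

theorem iterCurveFlatDist_limit (ρ : X → X → ℝ) (β : Ordinal.{0}) (hβ : Order.IsSuccLimit β)
    (x y : X) :
    iterCurveFlatDist ρ β x y = ⨅ γ : Set.Iio β, iterCurveFlatDist ρ γ.1 x y := by
  unfold iterCurveFlatDist
  rw [Ordinal.limitRecOn_limit _ _ _ _ hβ]

theorem bddAbove_curveFlatDist (ρ : X → X → ℝ) (p q : X) :
    BddAbove {r : ℝ | ∃ f : X → ℝ,
      (∀ x y, |f x - f y| ≤ ρ x y) ∧ IsCurveFlat ρ f ∧ r = |f p - f q|} :=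
  ⟨ρ p q, by rintro r ⟨f, hf, -, rfl⟩; exact hf p q⟩

theorem curveFlatDist_nonneg (ρ : X → X → ℝ) (p q : X) : 0 ≤ curveFlatDist ρ p q :=
  Real.sSup_nonneg (by rintro r ⟨f, -, -, rfl⟩; exact abs_nonneg _)

theorem curveFlatDist_le {ρ : X → X → ℝ} (h : IsPseudoDist ρ) (p q : X) :
    curveFlatDist ρ p q ≤ ρ p q :=
  Real.sSup_le (by rintro r ⟨f, hf, -, rfl⟩; exact hf p q) (h.nonneg p q)

theorem isPseudoDist_curveFlatDist {ρ : X → X → ℝ} (h : IsPseudoDist ρ) :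
    IsPseudoDist (curveFlatDist ρ) where
  self x := le_antisymm ((curveFlatDist_le h x x).trans (h.self x).le) (curveFlatDist_nonneg _ _ _)
  symm x y := by simp only [curveFlatDist, abs_sub_comm]
  triangle x y z := by
    refine Real.sSup_le ?_ (add_nonneg (curveFlatDist_nonneg _ _ _) (curveFlatDist_nonneg _ _ _))
    rintro r ⟨f, hf, hc, rfl⟩
    exact (abs_sub_le (f x) (f y) (f z)).trans (add_le_add
      (le_csSup (bddAbove_curveFlatDist ρ x y) ⟨f, hf, hc, rfl⟩)
      (le_csSup (bddAbove_curveFlatDist ρ y z) ⟨f, hf, hc, rfl⟩))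

theorem iterCurveFlatDist_aux {ρ : X → X → ℝ} (h : IsPseudoDist ρ) (α : Ordinal.{0}) :
    IsPseudoDist (iterCurveFlatDist ρ α) ∧
      ∀ β ≤ α, ∀ x y, iterCurveFlatDist ρ α x y ≤ iterCurveFlatDist ρ β x y := by
  induction α using Ordinal.limitRecOn with
  | zero =>
    refine ⟨by rwa [iterCurveFlatDist_zero], fun β hβ x y => ?_⟩
    rw [show β = 0 by simpa using hβ]
  | add_one α ih =>
    refine ⟨by rw [iterCurveFlatDist_add_one]; exact isPseudoDist_curveFlatDist ih.1,
      fun β hβ x y => ?_⟩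
    rcases hβ.eq_or_lt with rfl | hlt
    · exact le_rfl
    · refine le_trans ?_ (ih.2 β (Order.lt_add_one_iff.1 hlt) x y)
      rw [iterCurveFlatDist_add_one]
      exact curveFlatDist_le ih.1 x y
  | limit α hα ih =>
    have hne : Nonempty (Set.Iio α) := ⟨⟨0, hα.bot_lt⟩⟩
    have hbdd : ∀ x y, BddBelow (Set.range fun γ : Set.Iio α => iterCurveFlatDist ρ γ.1 x y) :=
      fun x y => ⟨0, by rintro _ ⟨γ, rfl⟩; exact (ih γ.1 γ.2).1.nonneg x y⟩
    refine ⟨⟨fun x => ?_, fun x y => ?_, fun x y z => ?_⟩, fun β hβ x y => ?_⟩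
    · rw [iterCurveFlatDist_limit ρ α hα]
      simp only [fun γ : Set.Iio α => (ih γ.1 γ.2).1.self x, ciInf_const]
    · rw [iterCurveFlatDist_limit ρ α hα, iterCurveFlatDist_limit ρ α hα]
      exact iInf_congr fun γ => (ih γ.1 γ.2).1.symm x y
    · simp only [iterCurveFlatDist_limit ρ α hα]
      refine le_ciInf_add_ciInf fun γ δ => ?_
      rcases le_total γ.1 δ.1 with hle | hle
      · exact (ciInf_le (hbdd x z) δ).trans (((ih δ.1 δ.2).1.triangle x y z).trans
          (add_le_add ((ih δ.1 δ.2).2 γ.1 hle x y) le_rfl))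
      · exact (ciInf_le (hbdd x z) γ).trans (((ih γ.1 γ.2).1.triangle x y z).trans
          (add_le_add le_rfl ((ih γ.1 γ.2).2 δ.1 hle y z)))
    · rcases hβ.eq_or_lt with rfl | hlt
      · exact le_rfl
      · rw [iterCurveFlatDist_limit ρ α hα]
        exact ciInf_le (hbdd x y) ⟨β, hlt⟩

end Raw

/-! ## Curve-flat quotients and the curve-flat index -/

/-- The set `X`, to be equipped with the pseudometric `d_cf^α`. -/
def CurveFlatSpace (X : Type u) (_α : Ordinal.{0}) : Type u := X

theorem isPseudoDist_dist (X : Type u) [PseudoMetricSpace X] :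
    IsPseudoDist (dist : X → X → ℝ) :=
  ⟨dist_self, dist_comm, dist_triangle⟩

instance (X : Type u) [PseudoMetricSpace X] (α : Ordinal.{0}) :
    PseudoMetricSpace (CurveFlatSpace X α) where
  dist := iterCurveFlatDist (dist : X → X → ℝ) α
  dist_self := (iterCurveFlatDist_aux (isPseudoDist_dist X) α).1.self
  dist_comm := (iterCurveFlatDist_aux (isPseudoDist_dist X) α).1.symm
  dist_triangle := (iterCurveFlatDist_aux (isPseudoDist_dist X) α).1.triangle

/-- The curve-flat quotient `X_cf^α` of order `α`: the metric space obtained from `(X, d_cf^α)`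
by identifying the points at distance zero. -/
abbrev CurveFlatQuotient (X : Type u) [PseudoMetricSpace X] (α : Ordinal.{0}) : Type u :=
  SeparationQuotient (CurveFlatSpace X α)

/-- The quotient map of `X` onto `X_cf^α`. -/
def toCurveFlatQuotient (X : Type u) [PseudoMetricSpace X] (α : Ordinal.{0}) (x : X) :
    CurveFlatQuotient X α :=
  SeparationQuotient.mk (show CurveFlatSpace X α from x)

/-- A metric space is purely `1`-unrectifiable if the image of every Lipschitz curve fragment is
null for the one-dimensional Hausdorff measure. -/
def IsPurelyOneUnrectifiable (X : Type u) [MetricSpace X] : Prop :=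
  ∀ (K : Set ℝ) (γ : ℝ → X), IsLipCurveFragment (dist : X → X → ℝ) K γ →
    @Measure.hausdorffMeasure X _ (borel X) (@BorelSpace.mk X _ (borel X) rfl) 1 (γ '' K) = 0

/-- `κ` is the curve-flat index of `X`: the least countable ordinal such that the curve-flat
quotient of order `κ` is purely `1`-unrectifiable. -/
def IsCurveFlatIndex (X : Type u) [MetricSpace X] (κ : Ordinal.{0}) : Prop :=
  IsLeast {β : Ordinal.{0} | β.card ≤ Cardinal.aleph0 ∧
    IsPurelyOneUnrectifiable (CurveFlatQuotient X β)} κ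

/-- `φ` is a `(1 + ε)`-isometry: a bijection with
`(1 - ε) d(p, q) ≤ d(φ p, φ q) ≤ (1 + ε) d(p, q)`. -/
def IsAlmostIsometry {X Y : Type u} [MetricSpace X] [MetricSpace Y] (ε : ℝ) (φ : X → Y) : Prop :=
  Function.Bijective φ ∧
    ∀ p q, (1 - ε) * dist p q ≤ dist (φ p) (φ q) ∧ dist (φ p) (φ q) ≤ (1 + ε) * dist p q

/-! ## Geodesic spaces and gapped segments -/

/-- A metric space is geodesic if any two distinct points `p`, `q` are joined by a curve whose
length is `d(p, q)`. -/
def IsGeodesicSpace (X : Type u) [MetricSpace X] : Prop :=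
  ∀ p q : X, p ≠ q → ∃ (a b : ℝ) (γ : ℝ → X), a ≤ b ∧ ContinuousOn γ (Icc a b) ∧
    γ a = p ∧ γ b = q ∧ eVariationOn γ (Icc a b) = edist p q

/-- A distortion: a concave function `[0, ∞) → [0, ∞)` vanishing at `0`. -/
def IsDistortion (ω : ℝ → ℝ) : Prop :=
  ConcaveOn ℝ (Ici 0) ω ∧ (∀ t, 0 ≤ t → 0 ≤ ω t) ∧ ω 0 = 0

/-- The interval `[0, w]` with an open interval of length `a` removed in the middle. -/
def gappedSegment (a w : ℝ) : Set ℝ :=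
  Icc 0 ((w - a) / 2) ∪ Icc ((w + a) / 2) w

/-- `X` is (isometric to) the gapped segment associated to a pair of points at distance `a > 0`
and a distortion `ω` with `ω a ≥ a`. -/
def IsGappedSegment (X : Type u) [MetricSpace X] : Prop :=
  ∃ (a : ℝ) (ω : ℝ → ℝ), 0 < a ∧ IsDistortion ω ∧ a ≤ ω a ∧
    Nonempty (X ≃ᵢ gappedSegment a (ω a))

end

-- The index of `M` exists because on a separable space only countably many stages can strictly
-- lower the pseudometric, while there are uncountably many countable ordinals.
--
-- The space `Y` is built by induction on `α`, for all compact `M` at once (`Collapsible`). Replace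
-- `d` by `snow c ∘ d`, which agrees with `d` at scales at least `c` and is a snowflake below `c`,
-- so that Lipschitz fragments do not see it. For each `k`, choose finitely many pairs `P`, `Q` in a
-- fine net, at distance at most `2c/2^k`, and join each pair by a gadget of order `b_k < α`, where
-- the `b_k` eventually exceed or equal each ordinal below `α`. By the induction hypothesis there is
-- a space whose stage `b_k` is a gapped segment of length `snow c (d(P,Q))` with gap `d(P,Q)`; this
-- is the gadget. One stage later its two solid parts are crushed, and two points at distance
-- `d(P,Q)` remain. By stage `α` every chosen pair has its true distance, and the nets yield the
-- factor `1 + ε`, asymptotically `1` at small scales (`exists_pairs`).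
--
-- For the lower bound, at a stage `β < α` only finitely many gadgets have been crushed, so `M` is
-- still a snowflake below a positive cutoff. `stageDist` glues this snowflake to the current states
-- of the gadgets. By `IsGlueData.nullOver` a fragment can be examined in the pieces: on `M` it is
-- null by the snowflake, on a gadget by the definition of the next stage. Induction on `β` gives
-- `stageDist_le_iter`, and in the end the distance of projections to `M` bounds stage `α` from
-- below (`dist_proj_le_iter`).
--
-- Hairs, which are collapses of intervals glued at a single point, make every stage before `α`
-- differ from stage `α`. Geodesic, gapped and finite spaces have the property `IsExact`, which
-- removes the error `ε`; the induction itself needs this for gapped segments and intervals.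
-- Finally, additivity of the iterates and bi-Lipschitz invariance of flatness turn the collapse
-- into the index `α + α_cf(M)`.

universe v w

/-! ### Lengths of gaps and null images of compact sets -/

section GapFun

/-- The total length of the part of `[0, t]` outside `K`, with sign. -/
noncomputable def gapFun (K : Set ℝ) (t : ℝ) : ℝ := ∫ x in (0 : ℝ)..t, Kᶜ.indicator (fun _ => (1 : ℝ)) x

theorem intervalIntegrable_indicator_compl {K : Set ℝ} (hK : MeasurableSet K) (a b : ℝ) :
    IntervalIntegrable (Kᶜ.indicator (fun _ => (1 : ℝ))) volume a b := by
  rw [intervalIntegrable_iff]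
  exact (integrableOn_const (by simp)).indicator hK.compl

theorem gapFun_sub {K : Set ℝ} (hK : MeasurableSet K) (s t : ℝ) :
    gapFun K t - gapFun K s = ∫ x in s..t, Kᶜ.indicator (fun _ => (1 : ℝ)) x :=
  intervalIntegral.integral_interval_sub_left (intervalIntegrable_indicator_compl hK _ _)
    (intervalIntegrable_indicator_compl hK _ _)

theorem gapFun_sub_eq_measureReal {K : Set ℝ} (hK : MeasurableSet K) {s t : ℝ} (hst : s ≤ t) :
    gapFun K t - gapFun K s = volume.real (Icc s t \ K) := by
  rw [gapFun_sub hK, intervalIntegral.integral_of_le hst, ← integral_Icc_eq_integral_Ioc,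
    integral_indicator hK.compl, Measure.restrict_restrict hK.compl, setIntegral_const, smul_eq_mul,
    mul_one, inter_comm, sdiff_eq]

theorem abs_gapFun_sub_le {K : Set ℝ} (hK : MeasurableSet K) (s t : ℝ) :
    |gapFun K s - gapFun K t| ≤ |s - t| := by
  wlog hst : s ≤ t generalizing s t
  · rw [abs_sub_comm, abs_sub_comm s]
    exact this t s (le_of_not_ge hst)
  rw [abs_sub_comm, abs_sub_comm s, gapFun_sub_eq_measureReal hK hst, abs_of_nonneg (by simp),
    abs_of_nonneg (by linarith), ← Real.volume_real_Icc_of_le hst]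
  exact measureReal_mono sdiff_subset (by simp)

theorem gapFun_Icc {a b s t : ℝ} (hs : s ∈ Icc a b) (ht : t ∈ Icc a b) :
    gapFun (Icc a b) s = gapFun (Icc a b) t := by
  wlog hst : s ≤ t generalizing s t
  · exact (this ht hs (le_of_not_ge hst)).symm
  have h := gapFun_sub_eq_measureReal (measurableSet_Icc (a := a) (b := b)) hst
  rw [sdiff_eq_empty.2 (Icc_subset_Icc hs.1 ht.2)] at h
  simp at h
  linarith

/-- A function with vanishing derivative within `s` at each point of `s` has null image. -/
theorem volume_image_eq_zero_of_hasDerivWithinAt_zero {f : ℝ → ℝ} {s : Set ℝ}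
    (h : ∀ x ∈ s, HasDerivWithinAt f 0 s x) : volume (f '' s) = 0 := by
  refine addHaar_image_eq_zero_of_det_fderivWithin_eq_zero volume
    (f' := fun _ => (0 : ℝ →L[ℝ] ℝ)) (fun x hx => ?_) (fun x _ => ?_)
  · have := (h x hx).hasFDerivWithinAt
    rwa [ContinuousLinearMap.toSpanSingleton_zero] at this
  · have : ((0 : ℝ →L[ℝ] ℝ)).det = 0 := by
      simp [ContinuousLinearMap.det]
    exact this

/-- A quadratic modulus of continuity forces the derivative within `s` to vanish. -/
theorem volume_image_eq_zero_of_sq {f : ℝ → ℝ} {s : Set ℝ} {C : ℝ}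
    (h : ∀ x ∈ s, ∀ y ∈ s, |f x - f y| ≤ C * |x - y| ^ 2) : volume (f '' s) = 0 := by
  refine volume_image_eq_zero_of_hasDerivWithinAt_zero fun x hx => ?_
  rw [hasDerivWithinAt_iff_isLittleO]
  have : (fun y => f y - f x - (y - x) • (0 : ℝ)) =O[nhdsWithin x s] fun y => (y - x) ^ 2 := by
    refine Asymptotics.IsBigO.of_bound C ?_
    filter_upwards [self_mem_nhdsWithin] with y hy
    simpa using h y hy x hx
  refine this.trans_isLittleO ?_
  refine Asymptotics.IsLittleO.mono ?_ nhdsWithin_le_nhds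
  have h1 : (fun y : ℝ => (y - x)) =o[nhds x] fun _ => (1 : ℝ) := by
    rw [Asymptotics.isLittleO_one_iff]
    have : ContinuousAt (fun y : ℝ => y - x) x := by fun_prop
    simpa [ContinuousAt] using this
  have h2 := h1.mul_isBigO (Asymptotics.isBigO_refl (fun y : ℝ => (y - x)) (nhds x))
  simpa [sq] using h2

theorem hausdorffMeasure_image_eq_zero_of_lipschitz {Y : Type u} [MetricSpace Y]
    [MeasurableSpace Y] [BorelSpace Y] {f : ℝ → Y} {s : Set ℝ} {C : ℝ}
    (h : ∀ x ∈ s, ∀ y ∈ s, dist (f x) (f y) ≤ C * |x - y|) (hs : volume s = 0) :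
    Measure.hausdorffMeasure (X := Y) 1 (f '' s) = 0 := by
  have hL : LipschitzOnWith C.toNNReal f s := by
    refine LipschitzOnWith.of_dist_le_mul fun x hx y hy => (h x hx y hy).trans ?_
    rw [Real.dist_eq]
    exact mul_le_mul_of_nonneg_right (Real.le_coe_toNNReal C) (abs_nonneg _)
  have := hL.hausdorffMeasure_image_le (d := 1) zero_le_one
  rw [hausdorffMeasure_real, hs, mul_zero] at this
  exact nonpos_iff_eq_zero.1 this

theorem volume_image_eq_zero_of_lipschitz {f : ℝ → ℝ} {s : Set ℝ} {C : ℝ}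
    (h : ∀ x ∈ s, ∀ y ∈ s, |f x - f y| ≤ C * |x - y|) (hs : volume s = 0) :
    volume (f '' s) = 0 := by
  rw [← hausdorffMeasure_real]
  exact hausdorffMeasure_image_eq_zero_of_lipschitz (C := C) h hs

/-- By Lebesgue differentiation the derivative is the indicator of the complement of `K`, hence zero
at almost every point of `K`. Such points have null image, and the exceptional null set has null
image because `gapFun` is `1`-Lipschitz. -/
theorem volume_gapFun_image {K : Set ℝ} (hK : MeasurableSet K) : volume (gapFun K '' K) = 0 := by
  have hloc : LocallyIntegrable (Kᶜ.indicator (fun _ => (1 : ℝ))) volume :=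
    (locallyIntegrable_const 1).indicator hK.compl
  have hae := LocallyIntegrable.ae_hasDerivAt_integral hloc
  set B := {x | ¬ ∀ c, HasDerivAt (fun x => ∫ (t : ℝ) in c..x, Kᶜ.indicator (fun _ => (1 : ℝ)) t)
    (Kᶜ.indicator (fun _ => (1 : ℝ)) x) x} with hB
  have hB0 : volume B = 0 := hae
  have hsub : gapFun K '' K ⊆ gapFun K '' (K \ B) ∪ gapFun K '' B := by
    rw [← image_union]
    exact image_mono (by rw [sdiff_union_self]; exact subset_union_left)
  refine measure_mono_null hsub (measure_union_null ?_ ?_)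
  · refine volume_image_eq_zero_of_hasDerivWithinAt_zero fun x hx => ?_
    have h1 : ∀ c, HasDerivAt (fun x => ∫ (t : ℝ) in c..x, Kᶜ.indicator (fun _ => (1 : ℝ)) t)
      (Kᶜ.indicator (fun _ => (1 : ℝ)) x) x := not_not.1 hx.2
    have h2 := h1 0
    rw [indicator_of_notMem (by simpa using hx.1)] at h2
    exact h2.hasDerivWithinAt
  · refine volume_image_eq_zero_of_lipschitz (C := 1) (fun x _ y _ => ?_) hB0
    simpa using abs_gapFun_sub_le hK x y

/-- If `f` varies on `K` by at most a multiple of the length of the gaps of `K`, then `f '' K` is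
null for the one-dimensional Hausdorff measure. -/
theorem hausdorffMeasure_image_eq_zero_of_gapFun {Y : Type u} [MetricSpace Y]
    [MeasurableSpace Y] [BorelSpace Y] {f : ℝ → Y} {K : Set ℝ} {C : ℝ} (hK : MeasurableSet K)
    (h : ∀ x ∈ K, ∀ y ∈ K, dist (f x) (f y) ≤ C * |gapFun K x - gapFun K y|)
    : Measure.hausdorffMeasure (X := Y) 1 (f '' K) = 0 := by
  classical
  rcases K.eq_empty_or_nonempty with rfl | ⟨x0, hx0⟩
  · simp
  -- On `K` the map `f` factors through `gapFun K`, so `f '' K` is a Lipschitz image of the null set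
  -- `gapFun K '' K`; `g` chooses preimages.
  have hex : ∀ r : ℝ, ∃ x, x ∈ K ∧ (r ∈ gapFun K '' K → gapFun K x = r) := by
    intro r
    by_cases hr : r ∈ gapFun K '' K
    · obtain ⟨x, hx, rfl⟩ := hr
      exact ⟨x, hx, fun _ => rfl⟩
    · exact ⟨x0, hx0, fun h => (hr h).elim⟩
  choose g hgK hg using hex
  have himg : f '' K = (fun r => f (g r)) '' (gapFun K '' K) := by
    rw [image_image]
    refine image_congr fun x hx => ?_
    have hm := mem_image_of_mem (gapFun K) hx
    have := h _ hx _ (hgK (gapFun K x))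
    rw [hg _ hm, sub_self, abs_zero, mul_zero] at this
    exact dist_le_zero.1 this
  rw [himg]
  refine hausdorffMeasure_image_eq_zero_of_lipschitz (C := C) (fun x hx y hy => ?_)
    (volume_gapFun_image hK)
  have := h _ (hgK x) _ (hgK y)
  rwa [hg x hx, hg y hy] at this

theorem volume_image_eq_zero_of_gapFun {f : ℝ → ℝ} {K : Set ℝ} {C : ℝ} (hK : MeasurableSet K)
    (h : ∀ x ∈ K, ∀ y ∈ K, |f x - f y| ≤ C * |gapFun K x - gapFun K y|) :
    volume (f '' K) = 0 := by
  rw [← hausdorffMeasure_real]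
  exact hausdorffMeasure_image_eq_zero_of_gapFun (C := C) hK h

end GapFun

/-! ### Functoriality and additivity of the iterated pseudometrics -/

section Iterates

variable {X : Type u} {Z : Type v}

theorem IsPseudoDist.iter {ρ : X → X → ℝ} (h : IsPseudoDist ρ) (α : Ordinal.{0}) :
    IsPseudoDist (iterCurveFlatDist ρ α) :=
  (iterCurveFlatDist_aux h α).1

theorem IsPseudoDist.iter_anti {ρ : X → X → ℝ} (h : IsPseudoDist ρ) {β α : Ordinal.{0}}
    (hβ : β ≤ α) (x y : X) : iterCurveFlatDist ρ α x y ≤ iterCurveFlatDist ρ β x y :=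
  (iterCurveFlatDist_aux h α).2 β hβ x y

theorem IsPseudoDist.iter_le {ρ : X → X → ℝ} (h : IsPseudoDist ρ) (α : Ordinal.{0}) (x y : X) :
    iterCurveFlatDist ρ α x y ≤ ρ x y := by
  simpa only [iterCurveFlatDist_zero] using h.iter_anti (zero_le (a := α)) x y

theorem IsPseudoDist.abs_sub_le {ρ : X → X → ℝ} (h : IsPseudoDist ρ) (p x y : X) :
    |ρ p x - ρ p y| ≤ ρ x y := by
  have h1 := h.triangle p x y
  have h2 := h.triangle p y x
  rw [h.symm y x] at h2
  exact abs_sub_le_iff.2 ⟨by linarith, by linarith⟩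

theorem IsPseudoDist.comp {ρ : X → X → ℝ} (h : IsPseudoDist ρ) (f : Z → X) :
    IsPseudoDist fun z w => ρ (f z) (f w) :=
  ⟨fun _ => h.self _, fun _ _ => h.symm _ _, fun _ _ _ => h.triangle _ _ _⟩

theorem le_iterCurveFlatDist_limit {ρ : X → X → ℝ} {β : Ordinal.{0}} (hβ : Order.IsSuccLimit β)
    {x y : X} {r : ℝ} (h : ∀ γ < β, r ≤ iterCurveFlatDist ρ γ x y) :
    r ≤ iterCurveFlatDist ρ β x y := by
  rw [iterCurveFlatDist_limit ρ β hβ]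
  have : Nonempty (Set.Iio β) := ⟨⟨0, hβ.bot_lt⟩⟩
  exact le_ciInf fun γ => h γ.1 γ.2

/-- A Lipschitz map remains Lipschitz, with the same constant, for the curve-flat pseudometrics. -/
theorem curveFlatDist_map_le {ρ : Z → Z → ℝ} {σ : X → X → ℝ} {φ : X → Z} {C : ℝ} (hC : 0 < C)
    (h : ∀ x y, ρ (φ x) (φ y) ≤ C * σ x y) (x y : X) :
    curveFlatDist ρ (φ x) (φ y) ≤ C * curveFlatDist σ x y := by
  refine Real.sSup_le ?_ (mul_nonneg hC.le (curveFlatDist_nonneg _ _ _))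
  rintro r ⟨f, hf, ⟨-, hc⟩, rfl⟩
  have h1 : ∀ x y, |C⁻¹ * f (φ x) - C⁻¹ * f (φ y)| ≤ σ x y := fun x y => by
    rw [← mul_sub, abs_mul, abs_of_pos (inv_pos.2 hC), inv_mul_le_iff₀ hC]
    exact (hf _ _).trans (h x y)
  have h2 : IsCurveFlat σ fun x => C⁻¹ * f (φ x) := by
    refine ⟨⟨1, fun x y => by simpa using h1 x y⟩, fun K γ ⟨hK, L, hL⟩ => ?_⟩
    have h3 := hc K (fun t => φ (γ t)) ⟨hK, C * L, fun s hs t ht => (h _ _).trans ?_⟩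
    · rw [hausdorffMeasure_real] at h3 ⊢
      have := volume_image_eq_zero_of_lipschitz (f := fun r => C⁻¹ * r) (C := |C⁻¹|)
        (fun x _ y _ => by rw [← mul_sub, abs_mul]) h3
      rwa [image_image] at this
    · rw [mul_assoc]
      exact mul_le_mul_of_nonneg_left (hL s hs t ht) hC.le
  rw [← inv_mul_le_iff₀ hC]
  refine le_csSup (bddAbove_curveFlatDist σ x y) ⟨_, h1, h2, ?_⟩
  rw [← mul_sub, abs_mul, abs_of_pos (inv_pos.2 hC)]

theorem iterCurveFlatDist_map_le_mul {ρ : Z → Z → ℝ} {σ : X → X → ℝ} (hρ : IsPseudoDist ρ)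
    {φ : X → Z} {C : ℝ} (hC : 0 < C) (h : ∀ x y, ρ (φ x) (φ y) ≤ C * σ x y) (β : Ordinal.{0}) :
    ∀ x y, iterCurveFlatDist ρ β (φ x) (φ y) ≤ C * iterCurveFlatDist σ β x y := by
  induction β using Ordinal.limitRecOn with
  | zero => simpa only [iterCurveFlatDist_zero] using h
  | add_one β ih =>
    simp only [iterCurveFlatDist_add_one]
    exact curveFlatDist_map_le hC ih
  | limit β hβ ih =>
    intro x y
    rw [← inv_mul_le_iff₀ hC]
    refine le_iterCurveFlatDist_limit hβ fun γ hγ => ?_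
    rw [inv_mul_le_iff₀ hC]
    exact (hρ.iter_anti hγ.le _ _).trans (ih γ hγ x y)

theorem iterCurveFlatDist_map_le {ρ : Z → Z → ℝ} {σ : X → X → ℝ} (hρ : IsPseudoDist ρ)
    {φ : X → Z} (h : ∀ x y, ρ (φ x) (φ y) ≤ σ x y) (β : Ordinal.{0}) (x y : X) :
    iterCurveFlatDist ρ β (φ x) (φ y) ≤ iterCurveFlatDist σ β x y := by
  simpa using iterCurveFlatDist_map_le_mul hρ one_pos (by simpa using h) β x y

theorem iterCurveFlatDist_add {ρ : X → X → ℝ} (hρ : IsPseudoDist ρ) (α β : Ordinal.{0}) :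
    iterCurveFlatDist ρ (α + β) = iterCurveFlatDist (iterCurveFlatDist ρ α) β := by
  induction β using Ordinal.limitRecOn with
  | zero => rw [add_zero, iterCurveFlatDist_zero]
  | add_one β ih => rw [← add_assoc, iterCurveFlatDist_add_one, iterCurveFlatDist_add_one, ih]
  | limit β hβ ih =>
    funext x y
    have hlim : Order.IsSuccLimit (α + β) := Ordinal.isSuccLimit_add α hβ
    refine le_antisymm ?_ ?_
    · refine le_iterCurveFlatDist_limit hβ fun γ hγ => ?_
      rw [← ih γ hγ]
      exact hρ.iter_anti (add_le_add_right hγ.le α) x y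
    · refine le_iterCurveFlatDist_limit hlim fun γ hγ => ?_
      rcases le_total γ α with h | h
      · exact ((hρ.iter α).iter_le β x y).trans (hρ.iter_anti h x y)
      · obtain ⟨δ, rfl⟩ := exists_add_of_le h
        have hδ : δ < β := lt_of_add_lt_add_left hγ
        rw [ih δ hδ]
        exact (hρ.iter α).iter_anti hδ.le x y

end Iterates

/-! ### Fragments, gaps and pure unrectifiability -/

section Gaps

variable {X : Type u} {Z : Type v}

theorem IsPseudoDist.lip_nonneg {ρ : X → X → ℝ} (hρ : IsPseudoDist ρ) {x y : X} {L s t : ℝ}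
    (hst : s ≠ t) (h : ρ x y ≤ L * |s - t|) : 0 ≤ L := by
  by_contra hL
  have := mul_neg_of_neg_of_pos (not_le.1 hL) (abs_pos.2 (sub_ne_zero.2 hst))
  linarith [hρ.nonneg x y]

/-- Along a Lipschitz curve fragment with domain `K`, the curve-flat pseudometric is bounded by a
multiple of the length of the gaps of `K`. -/
theorem curveFlatDist_le_gapFun {ρ : X → X → ℝ} (hρ : IsPseudoDist ρ) {K : Set ℝ}
    (hK : IsCompact K) {γ : ℝ → X} {L : ℝ}
    (h : ∀ s ∈ K, ∀ t ∈ K, ρ (γ s) (γ t) ≤ L * |s - t|) {s t : ℝ} (hs : s ∈ K) (ht : t ∈ K) :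
    curveFlatDist ρ (γ s) (γ t) ≤ L * |gapFun K s - gapFun K t| := by
  rcases eq_or_ne s t with rfl | hne
  · simp [(isPseudoDist_curveFlatDist hρ).self]
  wlog hst : s < t generalizing s t
  · rw [(isPseudoDist_curveFlatDist hρ).symm, abs_sub_comm]
    exact this ht hs hne.symm (lt_of_le_of_ne (not_lt.1 hst) hne.symm)
  have hL : 0 ≤ L := hρ.lip_nonneg hne (h s hs t ht)
  refine Real.sSup_le ?_ (mul_nonneg hL (abs_nonneg _))
  rintro r ⟨f, hf, ⟨-, hc⟩, rfl⟩
  have h0 := hc K γ ⟨hK, L, h⟩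
  rw [hausdorffMeasure_real] at h0
  have hlip : LipschitzOnWith L.toNNReal (fun t => f (γ t)) K :=
    LipschitzOnWith.of_dist_le_mul fun x hx y hy => by
      rw [Real.coe_toNNReal L hL]
      exact (hf _ _).trans (h x hx y hy)
  -- The extension to `ℝ` is continuous, so the interval between `g s` and `g t` is covered by the
  -- null set `g '' K` and by the image of the gaps, whose measure is at most `L` times their
  -- length.
  obtain ⟨g, hg, hgK⟩ := hlip.extend_real
  have hgs : f (γ s) = g s := hgK hs
  have hgt : f (γ t) = g t := hgK ht
  have himg : g '' K = (fun t => f (γ t)) '' K := image_congr fun x hx => (hgK hx).symm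
  have hsub : uIcc (g s) (g t) ⊆ g '' K ∪ g '' (Icc s t \ K) := by
    refine (intermediate_value_uIcc hg.continuous.continuousOn).trans ?_
    rw [uIcc_of_le hst.le, ← image_union]
    exact image_mono (by rw [union_sdiff_self]; exact subset_union_right)
  have hm : volume (g '' (Icc s t \ K)) ≤ L.toNNReal * volume (Icc s t \ K) := by
    have := hg.hausdorffMeasure_image_le zero_le_one (Icc s t \ K)
    simpa [hausdorffMeasure_real] using this
  have h1 : volume (uIcc (g s) (g t)) ≤ L.toNNReal * volume (Icc s t \ K) := by
    refine (measure_mono hsub).trans ((measure_union_le _ _).trans ?_)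
    rw [himg, h0, zero_add]
    exact hm
  have hfin : volume (Icc s t \ K) ≠ ⊤ :=
    ((measure_mono sdiff_subset).trans_lt measure_Icc_lt_top).ne
  have h2 := ENNReal.toReal_mono (ENNReal.mul_ne_top ENNReal.coe_ne_top hfin) h1
  rw [Real.volume_interval, ENNReal.toReal_ofReal (abs_nonneg _), ENNReal.toReal_mul,
    ENNReal.coe_toReal, Real.coe_toNNReal L hL] at h2
  rw [abs_sub_comm (gapFun K s), gapFun_sub_eq_measureReal hK.measurableSet hst.le,
    abs_of_nonneg measureReal_nonneg, hgs, hgt, abs_sub_comm]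
  exact h2

theorem curveFlatDist_eq_zero_of_curve {ρ : X → X → ℝ} (hρ : IsPseudoDist ρ) {a b : ℝ}
    {γ : ℝ → X} {L : ℝ} (h : ∀ s ∈ Icc a b, ∀ t ∈ Icc a b, ρ (γ s) (γ t) ≤ L * |s - t|) {s t : ℝ}
    (hs : s ∈ Icc a b) (ht : t ∈ Icc a b) : curveFlatDist ρ (γ s) (γ t) = 0 := by
  refine le_antisymm ?_ (curveFlatDist_nonneg _ _ _)
  have := curveFlatDist_le_gapFun hρ isCompact_Icc h hs ht
  rwa [gapFun_Icc hs ht, sub_self, abs_zero, mul_zero] at this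

/-- The pseudometric `ρ` has no non-trivial Lipschitz curve fragments. -/
def IsFlat (ρ : X → X → ℝ) : Prop :=
  ∀ (K : Set ℝ) (γ : ℝ → X), IsLipCurveFragment ρ K γ →
    ∃ C : ℝ, ∀ s ∈ K, ∀ t ∈ K, ρ (γ s) (γ t) ≤ C * |gapFun K s - gapFun K t|

theorem isFlat_of_curveFlatDist_eq {ρ : X → X → ℝ} (hρ : IsPseudoDist ρ)
    (h : curveFlatDist ρ = ρ) : IsFlat ρ := by
  rintro K γ ⟨hK, L, hL⟩
  refine ⟨L, fun s hs t ht => ?_⟩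
  have := curveFlatDist_le_gapFun hρ hK hL hs ht
  rwa [h] at this

/-- The functions `ρ p` are `1`-Lipschitz and attain `ρ p q`, so they suffice as test functions. -/
theorem curveFlatDist_eq_of_dist_isCurveFlat {ρ : X → X → ℝ} (hρ : IsPseudoDist ρ)
    (h : ∀ p, IsCurveFlat ρ (ρ p)) : curveFlatDist ρ = ρ := by
  funext p q
  refine le_antisymm (curveFlatDist_le hρ p q) ?_
  refine le_csSup (bddAbove_curveFlatDist ρ p q) ⟨ρ p, hρ.abs_sub_le p, h p, ?_⟩
  rw [hρ.self, zero_sub, abs_neg, abs_of_nonneg (hρ.nonneg p q)]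

theorem IsFlat.curveFlatDist_eq {ρ : X → X → ℝ} (hρ : IsPseudoDist ρ) (h : IsFlat ρ) :
    curveFlatDist ρ = ρ := by
  refine curveFlatDist_eq_of_dist_isCurveFlat hρ fun p =>
    ⟨⟨1, fun x y => by simpa using hρ.abs_sub_le p x y⟩, fun K γ hγ => ?_⟩
  obtain ⟨C, hC⟩ := h K γ hγ
  rw [hausdorffMeasure_real]
  exact volume_image_eq_zero_of_gapFun (C := C) hγ.1.measurableSet fun s hs t ht =>
    (hρ.abs_sub_le p _ _).trans (hC s hs t ht)

theorem isFlat_iff {ρ : X → X → ℝ} (hρ : IsPseudoDist ρ) : IsFlat ρ ↔ curveFlatDist ρ = ρ :=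
  ⟨fun h => h.curveFlatDist_eq hρ, isFlat_of_curveFlatDist_eq hρ⟩

theorem IsFlat.of_map {ρ : Z → Z → ℝ} {σ : X → X → ℝ} (h : IsFlat ρ) (φ : X → Z) {C C' : ℝ}
    (hC : 0 ≤ C) (hC' : 0 ≤ C') (h1 : ∀ x y, ρ (φ x) (φ y) ≤ C * σ x y)
    (h2 : ∀ x y, σ x y ≤ C' * ρ (φ x) (φ y)) : IsFlat σ := by
  rintro K γ ⟨hK, L, hL⟩
  obtain ⟨A, hA⟩ := h K (fun t => φ (γ t)) ⟨hK, C * L, fun s hs t ht => (h1 _ _).trans (by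
    rw [mul_assoc]; exact mul_le_mul_of_nonneg_left (hL s hs t ht) hC)⟩
  refine ⟨C' * A, fun s hs t ht => (h2 _ _).trans ?_⟩
  rw [mul_assoc]
  exact mul_le_mul_of_nonneg_left (hA s hs t ht) hC'

/-- If the quotient is unrectifiable, the functions `ρ p` have null images along fragments, being
`1`-Lipschitz on the quotient. Conversely, any section of the quotient map preserves distances, so
fragments lift, and the gap estimate makes their images null. -/
theorem isPurelyOneUnrectifiable_curveFlatQuotient_iff (X : Type u) [PseudoMetricSpace X]
    (β : Ordinal.{0}) : IsPurelyOneUnrectifiable (CurveFlatQuotient X β) ↔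
      IsFlat (iterCurveFlatDist (dist : X → X → ℝ) β) := by
  have hρ := (isPseudoDist_dist X).iter β
  have hmk : ∀ x y : X, dist (toCurveFlatQuotient X β x) (toCurveFlatQuotient X β y) =
      iterCurveFlatDist (dist : X → X → ℝ) β x y := fun x y => SeparationQuotient.dist_mk _ _
  let : MeasurableSpace (CurveFlatQuotient X β) := borel _
  have : BorelSpace (CurveFlatQuotient X β) := ⟨rfl⟩
  constructor
  · intro h
    refine isFlat_of_curveFlatDist_eq hρ (curveFlatDist_eq_of_dist_isCurveFlat hρ fun p =>
      ⟨⟨1, fun x y => by simpa using hρ.abs_sub_le p x y⟩, fun K γ ⟨hK, L, hL⟩ => ?_⟩)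
    have h1 := h K (fun t => toCurveFlatQuotient X β (γ t)) ⟨hK, L, fun s hs t ht => by
      rw [hmk]; exact hL s hs t ht⟩
    have h2 : LipschitzWith 1 fun z : CurveFlatQuotient X β => dist (toCurveFlatQuotient X β p) z :=
      LipschitzWith.dist_right _
    have h3 := h2.hausdorffMeasure_image_le zero_le_one
      ((fun t => toCurveFlatQuotient X β (γ t)) '' K)
    rw [image_image] at h3
    simp only [hmk] at h3
    refine nonpos_iff_eq_zero.1 (h3.trans (le_of_eq ?_))
    rw [show Measure.hausdorffMeasure (X := CurveFlatQuotient X β) 1 _ = 0 from h1, mul_zero]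
  · rintro h K γ ⟨hK, L, hL⟩
    have hsurj : Function.Surjective (toCurveFlatQuotient X β) :=
      SeparationQuotient.surjective_mk (X := CurveFlatSpace X β)
    obtain ⟨g, hg⟩ := hsurj.hasRightInverse
    obtain ⟨C, hC⟩ := h K (fun t => g (γ t)) ⟨hK, L, fun s hs t ht => by
      rw [← hmk, hg, hg]; exact hL s hs t ht⟩
    exact hausdorffMeasure_image_eq_zero_of_gapFun (C := C) hK.measurableSet fun s hs t ht => by
      have := hC s hs t ht
      rwa [← hmk, hg, hg] at this

end Gaps

/-! ### Fragments with arbitrary domains -/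

section Null

variable {X : Type u} {Z : Type v}

/-- Every sequence has a convergent subsequence for the pseudometric `ρ`. -/
def IsSeqCompactDist (ρ : X → X → ℝ) : Prop :=
  ∀ x : ℕ → X, ∃ a, ∃ φ : ℕ → ℕ, StrictMono φ ∧
    Filter.Tendsto (fun n => ρ (x (φ n)) a) Filter.atTop (nhds 0)

theorem IsSeqCompactDist.mono {ρ σ : X → X → ℝ} (h : IsSeqCompactDist ρ) (hσ : IsPseudoDist σ)
    (hle : ∀ x y, σ x y ≤ ρ x y) : IsSeqCompactDist σ := fun x => by
  obtain ⟨a, φ, hφ, ha⟩ := h x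
  exact ⟨a, φ, hφ, squeeze_zero (fun n => hσ.nonneg _ _) (fun n => hle _ _) ha⟩

/-- All functions that are `1`-Lipschitz for `σ` are null along all curve fragments, with arbitrary
domains, that are Lipschitz for `ρ`. -/
def NullOver (ρ σ : X → X → ℝ) : Prop :=
  ∀ (K : Set ℝ) (γ : ℝ → X) (L : ℝ), (∀ s ∈ K, ∀ t ∈ K, ρ (γ s) (γ t) ≤ L * |s - t|) →
    ∀ F : X → ℝ, (∀ x y, |F x - F y| ≤ σ x y) → volume ((fun t => F (γ t)) '' K) = 0

theorem NullOver.mono {ρ ρ' σ σ' : X → X → ℝ} (h : NullOver ρ σ) (hρ : ∀ x y, ρ x y ≤ ρ' x y)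
    (hσ : ∀ x y, σ' x y ≤ σ x y) : NullOver ρ' σ' := fun K γ L hL F hF =>
  h K γ L (fun s hs t ht => (hρ _ _).trans (hL s hs t ht)) F fun x y => (hF x y).trans (hσ x y)

/-- The functions `σ x` are admissible test functions. Lower bounds for curve-flat pseudometrics are
obtained in this way. -/
theorem NullOver.le_curveFlatDist {ρ σ : X → X → ℝ} (h : NullOver ρ σ) (hσ : IsPseudoDist σ)
    (hle : ∀ x y, σ x y ≤ ρ x y) (x y : X) : σ x y ≤ curveFlatDist ρ x y := by
  refine le_csSup (bddAbove_curveFlatDist ρ x y) ⟨σ x, fun z w => ?_, ⟨⟨1, fun z w => ?_⟩, ?_⟩, ?_⟩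
  · exact (hσ.abs_sub_le x z w).trans (hle z w)
  · simpa using (hσ.abs_sub_le x z w).trans (hle z w)
  · rintro K γ ⟨-, L, hL⟩
    rw [hausdorffMeasure_real]
    exact h K γ L hL (σ x) (hσ.abs_sub_le x)
  · rw [hσ.self, zero_sub, abs_neg, abs_of_nonneg (hσ.nonneg x y)]

theorem IsSeqCompactDist.exists_extension {ρ : X → X → ℝ} (hρ : IsPseudoDist ρ)
    (hc : IsSeqCompactDist ρ) {K : Set ℝ} {γ : ℝ → X} {L : ℝ}
    (hL : ∀ s ∈ K, ∀ t ∈ K, ρ (γ s) (γ t) ≤ L * |s - t|) {t : ℝ} (ht : t ∈ closure K) :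
    ∃ x, ∀ s ∈ K, ρ (γ s) x ≤ L * |s - t| := by
  obtain ⟨u, huK, hu⟩ := mem_closure_iff_seq_limit.1 ht
  obtain ⟨x, φ, hφ, hx⟩ := hc fun n => γ (u n)
  refine ⟨x, fun s hs => ?_⟩
  have h1 : Filter.Tendsto (fun n => L * |s - u (φ n)| + ρ (γ (u (φ n))) x) Filter.atTop
      (nhds (L * |s - t| + 0)) :=
    (((tendsto_const_nhds.sub (hu.comp hφ.tendsto_atTop)).abs).const_mul L).add hx
  rw [add_zero] at h1
  exact ge_of_tendsto' h1 fun n =>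
    (hρ.triangle _ (γ (u (φ n))) _).trans (add_le_add (hL s hs _ (huK _)) le_rfl)

/-- Cut the domain into bounded parts and extend the fragment to the compact closure by sequential
compactness. The gap estimate there gives a null image. Arbitrary domains matter because the part of
a fragment lying in one glued piece need not be compact. -/
theorem IsSeqCompactDist.nullOver_curveFlatDist {ρ : X → X → ℝ} (hρ : IsPseudoDist ρ)
    (hc : IsSeqCompactDist ρ) : NullOver ρ (curveFlatDist ρ) := by
  classical
  intro K γ L hL F hF
  wlog hK : Bornology.IsBounded K generalizing K
  · have hU : (fun t => F (γ t)) '' K = ⋃ n : ℕ, (fun t => F (γ t)) '' (K ∩ Metric.closedBall 0 n) := by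
      rw [← image_iUnion, Metric.iUnion_inter_closedBall_nat]
    rw [hU]
    refine measure_iUnion_null fun n => this _ (fun s hs t ht => hL s hs.1 t ht.1) ?_
    exact Metric.isBounded_closedBall.subset inter_subset_right
  have hcK : IsCompact (closure K) := hK.isCompact_closure
  rcases K.eq_empty_or_nonempty with rfl | ⟨t0, ht0⟩
  · simp
  have hex : ∀ t, ∃ x, t ∈ closure K → ∀ s ∈ K, ρ (γ s) x ≤ L * |s - t| := fun t => by
    by_cases ht : t ∈ closure K
    · obtain ⟨x, hx⟩ := hc.exists_extension hρ hL ht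
      exact ⟨x, fun _ => hx⟩
    · exact ⟨γ t0, fun h => (ht h).elim⟩
  choose γ' hγ' using hex
  have hL' : ∀ s ∈ closure K, ∀ t ∈ closure K, ρ (γ' s) (γ' t) ≤ L * |s - t| := by
    intro s hs t ht
    obtain ⟨u, huK, hu⟩ := mem_closure_iff_seq_limit.1 hs
    have h1 : Filter.Tendsto (fun n => L * |u n - s| + L * |u n - t|) Filter.atTop
        (nhds (L * |s - s| + L * |s - t|)) :=
      (((hu.sub tendsto_const_nhds).abs).const_mul L).add
        (((hu.sub tendsto_const_nhds).abs).const_mul L)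
    rw [sub_self, abs_zero, mul_zero, zero_add] at h1
    refine ge_of_tendsto' h1 fun n => (hρ.triangle _ (γ (u n)) _).trans (add_le_add ?_ ?_)
    · rw [hρ.symm]; exact hγ' s hs _ (huK n)
    · exact hγ' t ht _ (huK n)
  have hFK : ∀ t ∈ K, F (γ t) = F (γ' t) := fun t ht => by
    have h1 := hγ' t (subset_closure ht) t ht
    rw [sub_self, abs_zero, mul_zero] at h1
    have h2 := ((hF (γ t) (γ' t)).trans (curveFlatDist_le hρ _ _)).trans h1
    exact sub_eq_zero.1 (abs_eq_zero.1 (le_antisymm h2 (abs_nonneg _)))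
  have h0 : volume ((fun t => F (γ' t)) '' closure K) = 0 :=
    volume_image_eq_zero_of_gapFun (C := L) isClosed_closure.measurableSet fun s hs t ht =>
      (hF _ _).trans (curveFlatDist_le_gapFun hρ hcK hL' hs ht)
  refine measure_mono_null ?_ h0
  rintro _ ⟨t, ht, rfl⟩
  exact ⟨t, subset_closure ht, (hFK t ht).symm⟩

theorem isSeqCompactDist_dist (X : Type u) [PseudoMetricSpace X] [CompactSpace X] :
    IsSeqCompactDist (dist : X → X → ℝ) := fun x => by
  obtain ⟨a, φ, hφ, ha⟩ := CompactSpace.tendsto_subseq x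
  exact ⟨a, φ, hφ, tendsto_iff_dist_tendsto_zero.1 ha⟩

end Null

/-! ### Existence of the curve-flat index -/

section Index

open Cardinal Ordinal

theorem not_countable_countable_ordinals : ¬ {β : Ordinal.{0} | β.card ≤ ℵ₀}.Countable := by
  intro h
  have : Countable {β : Ordinal.{0} | β.card ≤ ℵ₀} := h
  have hlt : ∀ β : Ordinal.{0}, β < ω₁ ↔ β.card ≤ ℵ₀ := fun β => by
    rw [← Cardinal.ord_aleph 1, lt_ord, ← succ_aleph0, Order.lt_succ_iff]
  have h1 := Ordinal.iSup_lt_omega_one (f := fun β : {β : Ordinal.{0} | β.card ≤ ℵ₀} => β.1 + 1)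
    fun β => by
      have := (hlt β.1).2 β.2
      exact (isSuccLimit_omega 1).add_one_lt this
  have h2 := le_ciSup (f := fun β : {β : Ordinal.{0} | β.card ≤ ℵ₀} => β.1 + 1)
    (Ordinal.bddAbove_of_small) ⟨_, (hlt _).1 h1⟩
  exact absurd h2 (not_le.2 (Order.lt_add_one_iff.2 le_rfl))

/-- A stage that is not flat strictly lowers some distance, hence the distance of some pair from a
dense sequence, and a rational separates the two values. As the stages decrease, the resulting
triples are distinct for distinct stages. -/
theorem countable_not_isFlat_iter (M : Type u) [MetricSpace M] [TopologicalSpace.SeparableSpace M] :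
    {β : Ordinal.{0} | ¬ IsFlat (iterCurveFlatDist (dist : M → M → ℝ) β)}.Countable := by
  rcases isEmpty_or_nonempty M with hM | hM
  · refine (countable_empty).mono fun β hβ => hβ fun K γ _ => (hM.elim (γ 0))
  have hd := isPseudoDist_dist M
  set D := TopologicalSpace.denseSeq M
  have hex : ∀ β ∈ {β : Ordinal.{0} | ¬ IsFlat (iterCurveFlatDist (dist : M → M → ℝ) β)},
      ∃ p : ℕ × ℕ × ℚ, iterCurveFlatDist (dist : M → M → ℝ) (β + 1) (D p.1) (D p.2.1) < p.2.2 ∧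
        (p.2.2 : ℝ) < iterCurveFlatDist (dist : M → M → ℝ) β (D p.1) (D p.2.1) := by
    intro β hβ
    have hβ' : curveFlatDist (iterCurveFlatDist (dist : M → M → ℝ) β) ≠
      iterCurveFlatDist (dist : M → M → ℝ) β := fun h => hβ ((isFlat_iff (hd.iter β)).2 h)
    rw [← iterCurveFlatDist_add_one] at hβ'
    obtain ⟨x, y, hxy⟩ : ∃ x y, iterCurveFlatDist (dist : M → M → ℝ) (β + 1) x y <
        iterCurveFlatDist (dist : M → M → ℝ) β x y := by
      by_contra! hcon
      exact hβ' (funext₂ fun x y => le_antisymm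
        (hd.iter_anti (Order.le_succ β) x y) (hcon x y))
    set e := iterCurveFlatDist (dist : M → M → ℝ) β x y -
      iterCurveFlatDist (dist : M → M → ℝ) (β + 1) x y with he
    have hepos : 0 < e := sub_pos.2 hxy
    -- Moving each endpoint by less than `e / 8` changes every iterated distance by less than `e /
    -- 4`, so a drop of more than `e / 2` survives.
    obtain ⟨_, ⟨m, rfl⟩, hm⟩ := Metric.mem_closure_iff.1
      ((TopologicalSpace.denseRange_denseSeq M).closure_range ▸ mem_univ x) (e / 8) (by positivity)
    obtain ⟨_, ⟨n, rfl⟩, hn⟩ := Metric.mem_closure_iff.1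
      ((TopologicalSpace.denseRange_denseSeq M).closure_range ▸ mem_univ y) (e / 8) (by positivity)
    have hcl : ∀ δ : Ordinal.{0}, |iterCurveFlatDist (dist : M → M → ℝ) δ x y -
        iterCurveFlatDist (dist : M → M → ℝ) δ (D m) (D n)| < e / 4 := fun δ => by
      have h1 := ((hd.iter δ).abs_sub_le x y (D n)).trans (hd.iter_le δ _ _)
      have h2 := ((hd.iter δ).abs_sub_le (D n) x (D m)).trans (hd.iter_le δ _ _)
      rw [(hd.iter δ).symm (D n) x, (hd.iter δ).symm (D n) (D m)] at h2
      rw [abs_le] at h1 h2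
      rw [abs_lt]
      constructor <;> linarith [h1.1, h1.2, h2.1, h2.2]
    have h1 := abs_lt.1 (hcl β)
    have h2 := abs_lt.1 (hcl (β + 1))
    obtain ⟨q, hq1, hq2⟩ := exists_rat_btwn (show iterCurveFlatDist (dist : M → M → ℝ) (β + 1)
      (D m) (D n) < iterCurveFlatDist (dist : M → M → ℝ) β (D m) (D n) by linarith [h1.2, h2.1])
    exact ⟨⟨m, n, q⟩, hq1, hq2⟩
  choose! f hf using hex
  refine MapsTo.countable_of_injOn (mapsTo_univ f _) ?_ countable_univ
  have key : ∀ β ∈ {β : Ordinal.{0} | ¬ IsFlat (iterCurveFlatDist (dist : M → M → ℝ) β)},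
      ∀ δ ∈ {β : Ordinal.{0} | ¬ IsFlat (iterCurveFlatDist (dist : M → M → ℝ) β)},
      β < δ → f β ≠ f δ := by
    intro β hβ δ hδ hlt heq
    have h1 := (hf β hβ).1
    have h2 := (hf δ hδ).2
    rw [← heq] at h2
    have h3 := hd.iter_anti (Order.add_one_le_iff.2 hlt) (D (f β).1) (D (f β).2.1)
    linarith
  intro β hβ δ hδ heq
  rcases lt_trichotomy β δ with h | h | h
  · exact (key β hβ δ hδ h heq).elim
  · exact h
  · exact (key δ hδ β hβ h heq.symm).elim

/-- The curve-flat index of a separable metric space exists. -/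
theorem exists_isCurveFlatIndex (M : Type u) [MetricSpace M] [TopologicalSpace.SeparableSpace M] :
    ∃ κ, IsCurveFlatIndex M κ := by
  obtain ⟨β, hβ, hflat⟩ : ∃ β : Ordinal.{0}, β.card ≤ ℵ₀ ∧
      IsFlat (iterCurveFlatDist (dist : M → M → ℝ) β) := by
    by_contra! h
    exact not_countable_countable_ordinals ((countable_not_isFlat_iter M).mono h)
  have hne : {β : Ordinal.{0} | β.card ≤ ℵ₀ ∧
      IsPurelyOneUnrectifiable (CurveFlatQuotient M β)}.Nonempty :=
    ⟨β, hβ, (isPurelyOneUnrectifiable_curveFlatQuotient_iff M β).2 hflat⟩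
  exact ⟨_, csInf_mem hne, fun δ hδ => csInf_le' hδ⟩

end Index

/-! ### Gluing pieces to a base along two points -/

section Glue

variable {M : Type u} {I : Type v} {G : I → Type w}

/-- Distance to the points of `M` in the space obtained by gluing the point `p i` of `G i` to
`P i` and the point `q i` to `Q i`. -/
def footDist (D : M → M → ℝ) (h : ∀ i, G i → G i → ℝ) (P Q : I → M) (p q : ∀ i, G i) :
    M ⊕ (Σ i, G i) → M → ℝ
  | .inl x, y => D x y
  | .inr z, y => min (h z.1 z.2 (p z.1) + D (P z.1) y) (h z.1 z.2 (q z.1) + D (Q z.1) y)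

/-- Length of the shortest paths through `M` in the glued space. -/
noncomputable def throughDist (D : M → M → ℝ) (h : ∀ i, G i → G i → ℝ) (P Q : I → M)
    (p q : ∀ i, G i) (z w : M ⊕ (Σ i, G i)) : ℝ :=
  ⨅ y, footDist D h P Q p q z y + footDist D h P Q p q w y

/-- The pseudometric on the disjoint union of `M` and the `G i` that glues `p i` to `P i` and
`q i` to `Q i`. -/
noncomputable def glueDist (D : M → M → ℝ) (h : ∀ i, G i → G i → ℝ) (P Q : I → M)
    (p q : ∀ i, G i) (z w : M ⊕ (Σ i, G i)) : ℝ :=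
  sInf (insert (throughDist D h P Q p q z w)
    {r | ∃ i, ∃ a b : G i, z = .inr ⟨i, a⟩ ∧ w = .inr ⟨i, b⟩ ∧ r = h i a b})

/-- The data for `glueDist` are pseudometrics, and gluing does not force `M` to shrink. -/
structure IsGlueData (D : M → M → ℝ) (h : ∀ i, G i → G i → ℝ) (P Q : I → M)
    (p q : ∀ i, G i) : Prop where
  base : IsPseudoDist D
  piece : ∀ i, IsPseudoDist (h i)
  width : ∀ i, D (P i) (Q i) ≤ h i (p i) (q i)

variable {D : M → M → ℝ} {h : ∀ i, G i → G i → ℝ} {P Q : I → M} {p q : ∀ i, G i}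

theorem IsGlueData.foot_nonneg (H : IsGlueData D h P Q p q) (z : M ⊕ (Σ i, G i)) (y : M) :
    0 ≤ footDist D h P Q p q z y := by
  rcases z with x | ⟨i, z⟩
  · exact H.base.nonneg x y
  · exact le_min (add_nonneg ((H.piece i).nonneg _ _) (H.base.nonneg _ _))
      (add_nonneg ((H.piece i).nonneg _ _) (H.base.nonneg _ _))

theorem IsGlueData.foot_le (H : IsGlueData D h P Q p q) (z : M ⊕ (Σ i, G i)) (y y' : M) :
    footDist D h P Q p q z y ≤ footDist D h P Q p q z y' + D y' y := by
  rcases z with x | ⟨i, z⟩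
  · exact H.base.triangle _ _ _
  · simp only [footDist]
    rw [← min_add_add_right]
    exact min_le_min (by linarith [H.base.triangle (P i) y' y])
      (by linarith [H.base.triangle (Q i) y' y])

/-- Crossing a piece from one end to the other costs at least the distance of its attaching points,
by `width`; a detour through `z` is therefore never a shortcut. -/
theorem IsGlueData.le_foot_add_foot (H : IsGlueData D h P Q p q) (z : M ⊕ (Σ i, G i)) (y y' : M) :
    D y y' ≤ footDist D h P Q p q z y + footDist D h P Q p q z y' := by
  rcases z with x | ⟨i, z⟩
  · have := H.base.triangle y x y'
    rwa [H.base.symm y x] at this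
  · simp only [footDist]
    have h1 := H.width i
    have h2 := (H.piece i).triangle (p i) z (q i)
    rw [(H.piece i).symm (p i) z] at h2
    have h3 := H.base.symm y (P i)
    have h4 := H.base.symm y (Q i)
    have h5 := (H.piece i).nonneg z (p i)
    have h6 := (H.piece i).nonneg z (q i)
    have h7 := H.base.symm (Q i) (P i)
    rcases min_choice (h i z (p i) + D (P i) y) (h i z (q i) + D (Q i) y) with e | e <;>
    rcases min_choice (h i z (p i) + D (P i) y') (h i z (q i) + D (Q i) y') with e' | e' <;>
    rw [e, e']
    · linarith [H.base.triangle y (P i) y']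
    · linarith [H.base.triangle y (P i) y', H.base.triangle (P i) (Q i) y']
    · linarith [H.base.triangle y (Q i) y', H.base.triangle (Q i) (P i) y']
    · linarith [H.base.triangle y (Q i) y']

theorem IsGlueData.foot_inr_le (H : IsGlueData D h P Q p q) (i : I) (a b : G i) (y : M) :
    footDist D h P Q p q (.inr ⟨i, a⟩) y ≤ h i a b + footDist D h P Q p q (.inr ⟨i, b⟩) y := by
  simp only [footDist]
  rw [← min_add_add_left]
  exact min_le_min (by linarith [(H.piece i).triangle a b (p i)])
      (by linarith [(H.piece i).triangle a b (q i)])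

theorem IsGlueData.throughDist_le (H : IsGlueData D h P Q p q) (z w : M ⊕ (Σ i, G i)) (y : M) :
    throughDist D h P Q p q z w ≤ footDist D h P Q p q z y + footDist D h P Q p q w y :=
  ciInf_le ⟨0, by rintro _ ⟨y, rfl⟩; exact add_nonneg (H.foot_nonneg _ _) (H.foot_nonneg _ _)⟩ y

theorem IsGlueData.bddBelow (H : IsGlueData D h P Q p q) (z w : M ⊕ (Σ i, G i)) :
    BddBelow (insert (throughDist D h P Q p q z w)
      {r | ∃ i, ∃ a b : G i, z = .inr ⟨i, a⟩ ∧ w = .inr ⟨i, b⟩ ∧ r = h i a b}) := by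
  refine BddBelow.insert _ ⟨0, ?_⟩
  rintro _ ⟨i, a, b, -, -, rfl⟩
  exact (H.piece i).nonneg a b

theorem IsGlueData.glueDist_le_throughDist (H : IsGlueData D h P Q p q) (z w : M ⊕ (Σ i, G i)) :
    glueDist D h P Q p q z w ≤ throughDist D h P Q p q z w :=
  csInf_le (H.bddBelow z w) (mem_insert _ _)

theorem IsGlueData.glueDist_le_foot (H : IsGlueData D h P Q p q) (z w : M ⊕ (Σ i, G i)) (y : M) :
    glueDist D h P Q p q z w ≤ footDist D h P Q p q z y + footDist D h P Q p q w y :=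
  (H.glueDist_le_throughDist z w).trans (H.throughDist_le z w y)

theorem IsGlueData.glueDist_inr_le (H : IsGlueData D h P Q p q) (i : I) (a b : G i) :
    glueDist D h P Q p q (.inr ⟨i, a⟩) (.inr ⟨i, b⟩) ≤ h i a b :=
  csInf_le (H.bddBelow _ _) (mem_insert_of_mem _ ⟨i, a, b, rfl, rfl, rfl⟩)

theorem IsGlueData.glueDist_inl_le (H : IsGlueData D h P Q p q) (x y : M) :
    glueDist D h P Q p q (.inl x) (.inl y) ≤ D x y := by
  refine (H.glueDist_le_foot _ _ y).trans ?_
  simp [footDist, H.base.self]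

theorem IsGlueData.glueDist_inl_inr_p (H : IsGlueData D h P Q p q) (i : I) :
    glueDist D h P Q p q (.inl (P i)) (.inr ⟨i, p i⟩) ≤ 0 := by
  refine (H.glueDist_le_foot _ _ (P i)).trans ?_
  simp [footDist, H.base.self, (H.piece i).self]

theorem IsGlueData.glueDist_inl_inr_q (H : IsGlueData D h P Q p q) (i : I) :
    glueDist D h P Q p q (.inl (Q i)) (.inr ⟨i, q i⟩) ≤ 0 := by
  refine (H.glueDist_le_foot _ _ (Q i)).trans ?_
  simp [footDist, H.base.self, (H.piece i).self]

theorem IsGlueData.glueDist_le_of_size (H : IsGlueData D h P Q p q) {A r : ℝ}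
    (hA : ∀ x y, D x y ≤ A) (hr0 : 0 ≤ r) (hr : ∀ i a b, h i a b ≤ r) (z w : M ⊕ (Σ i, G i)) :
    glueDist D h P Q p q z w ≤ r + A + r := by
  have hf : ∀ z : M ⊕ (Σ i, G i), ∃ x, footDist D h P Q p q z x ≤ r := by
    rintro (x | ⟨i, z⟩)
    · exact ⟨x, (H.base.self x).le.trans hr0⟩
    · refine ⟨P i, (min_le_left _ _).trans ?_⟩
      simpa [H.base.self] using hr i z (p i)
  obtain ⟨x, hx⟩ := hf z
  obtain ⟨y, hy⟩ := hf w
  have h1 := H.glueDist_le_foot z w y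
  have h2 := H.foot_le z y x
  linarith [hA x y]

variable [Nonempty M]

theorem le_glueDist {z w : M ⊕ (Σ i, G i)} {r : ℝ}
    (h1 : ∀ y, r ≤ footDist D h P Q p q z y + footDist D h P Q p q w y)
    (h2 : ∀ i, ∀ a b : G i, z = .inr ⟨i, a⟩ → w = .inr ⟨i, b⟩ → r ≤ h i a b) :
    r ≤ glueDist D h P Q p q z w := by
  refine le_csInf (insert_nonempty _ _) ?_
  rintro _ (rfl | ⟨i, a, b, hz, hw, rfl⟩)
  · exact le_ciInf h1
  · exact h2 i a b hz hw

theorem IsGlueData.isPseudoDist (H : IsGlueData D h P Q p q) :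
    IsPseudoDist (glueDist D h P Q p q) where
  self z := by
    refine le_antisymm ?_ (le_glueDist
      (fun y => add_nonneg (H.foot_nonneg _ _) (H.foot_nonneg _ _))
      fun i a b _ _ => (H.piece i).nonneg _ _)
    rcases z with x | ⟨i, z⟩
    · exact (H.glueDist_inl_le x x).trans (H.base.self x).le
    · exact (H.glueDist_inr_le i z z).trans ((H.piece i).self z).le
  symm z w := by
    suffices hs : ∀ z w, glueDist D h P Q p q z w ≤ glueDist D h P Q p q w z from
      le_antisymm (hs _ _) (hs _ _)
    intro z w
    refine le_glueDist (fun y => ?_) ?_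
    · rw [add_comm]; exact H.glueDist_le_foot z w y
    · rintro i a b rfl rfl
      rw [(H.piece i).symm]
      exact H.glueDist_inr_le i b a
  triangle z w v := by
    rw [← sub_le_iff_le_add]
    refine le_glueDist (fun y => ?_) ?_
    · rw [sub_le_comm]
      refine le_glueDist (fun y' => ?_) ?_
      · have h1 := H.glueDist_le_foot z v y
        have h2 := H.le_foot_add_foot w y y'
        have h3 := H.foot_le v y y'
        rw [H.base.symm y' y] at h3
        linarith
      · rintro i a b rfl rfl
        have h1 := H.glueDist_le_foot z (.inr ⟨i, b⟩) y
        have h2 := H.foot_inr_le i b a y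
        rw [(H.piece i).symm b a] at h2
        linarith
    · rintro i a b rfl rfl
      rw [sub_le_comm]
      refine le_glueDist (fun y' => ?_) ?_
      · have h1 := H.glueDist_le_foot (.inr ⟨i, a⟩) v y'
        have h2 := H.foot_inr_le i a b y'
        linarith
      · rintro j a' b' heq rfl
        cases heq
        have h1 := H.glueDist_inr_le i a b'
        have h2 := (H.piece i).triangle a b b'
        linarith

/-- The glued pseudometric is the largest one compatible with the pieces and the gluing. -/
theorem le_glueDist_of_isPseudoDist {θ : M ⊕ (Σ i, G i) → M ⊕ (Σ i, G i) → ℝ}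
    (hθ : IsPseudoDist θ) (h1 : ∀ x y, θ (.inl x) (.inl y) ≤ D x y)
    (h2 : ∀ i, ∀ a b : G i, θ (.inr ⟨i, a⟩) (.inr ⟨i, b⟩) ≤ h i a b)
    (h3 : ∀ i, θ (.inl (P i)) (.inr ⟨i, p i⟩) ≤ 0) (h4 : ∀ i, θ (.inl (Q i)) (.inr ⟨i, q i⟩) ≤ 0)
    (z w : M ⊕ (Σ i, G i)) : θ z w ≤ glueDist D h P Q p q z w := by
  have hf : ∀ z y, θ z (.inl y) ≤ footDist D h P Q p q z y := by
    rintro (x | ⟨i, z⟩) y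
    · exact h1 x y
    · refine le_min ?_ ?_
      · have e1 := hθ.triangle (.inr ⟨i, z⟩) (.inr ⟨i, p i⟩) (.inl y)
        have e2 := hθ.triangle (.inr ⟨i, p i⟩) (.inl (P i)) (.inl y)
        rw [hθ.symm (.inr ⟨i, p i⟩) (.inl (P i))] at e2
        linarith [h3 i, h2 i z (p i), h1 (P i) y]
      · have e1 := hθ.triangle (.inr ⟨i, z⟩) (.inr ⟨i, q i⟩) (.inl y)
        have e2 := hθ.triangle (.inr ⟨i, q i⟩) (.inl (Q i)) (.inl y)
        rw [hθ.symm (.inr ⟨i, q i⟩) (.inl (Q i))] at e2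
        linarith [h4 i, h2 i z (q i), h1 (Q i) y]
  refine le_glueDist (fun y => ?_) ?_
  · have := hθ.triangle z (.inl y) w
    rw [hθ.symm (.inl y) w] at this
    linarith [hf z y, hf w y]
  · rintro i a b rfl rfl
    exact h2 i a b

theorem IsGlueData.mono {D' : M → M → ℝ} {h' : ∀ i, G i → G i → ℝ}
    (H : IsGlueData D h P Q p q) (hD : ∀ x y, D x y ≤ D' x y)
    (hh : ∀ i a b, h i a b ≤ h' i a b) (z w : M ⊕ (Σ i, G i)) :
    glueDist D h P Q p q z w ≤ glueDist D' h' P Q p q z w :=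
  le_glueDist_of_isPseudoDist H.isPseudoDist (fun x y => (H.glueDist_inl_le x y).trans (hD x y))
    (fun i a b => (H.glueDist_inr_le i a b).trans (hh i a b)) H.glueDist_inl_inr_p
    H.glueDist_inl_inr_q z w

theorem IsGlueData.glueDist_inl (H : IsGlueData D h P Q p q) (x y : M) :
    glueDist D h P Q p q (.inl x) (.inl y) = D x y := by
  refine le_antisymm (H.glueDist_inl_le x y) (le_glueDist (fun z => ?_) (by simp))
  simp only [footDist]
  rw [H.base.symm y z]
  exact H.base.triangle x z y

/-- A path that leaves the piece and comes back by the same end is not shorter than `h i a b`; one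
that comes back by the other end has to travel from `P i` to `Q i` in the base. -/
theorem IsGlueData.min_le_glueDist (H : IsGlueData D h P Q p q) (i : I) (a b : G i) :
    min (h i a b) (D (P i) (Q i)) ≤ glueDist D h P Q p q (.inr ⟨i, a⟩) (.inr ⟨i, b⟩) := by
  refine le_glueDist (fun y => ?_) ?_
  · simp only [footDist]
    have e1 := (H.piece i).triangle a (p i) b
    have e2 := (H.piece i).triangle a (q i) b
    have e3 := H.base.triangle (P i) y (Q i)
    rw [H.base.symm y] at e3
    have n1 := (H.piece i).nonneg a (p i)
    have n2 := (H.piece i).nonneg a (q i)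
    have n3 := (H.piece i).nonneg b (p i)
    have n4 := (H.piece i).nonneg b (q i)
    have n5 := H.base.nonneg (P i) y
    have n6 := H.base.nonneg (Q i) y
    rw [(H.piece i).symm (p i) b] at e1
    rw [(H.piece i).symm (q i) b] at e2
    rcases min_choice (h i a (p i) + D (P i) y) (h i a (q i) + D (Q i) y) with e | e <;>
    rcases min_choice (h i b (p i) + D (P i) y) (h i b (q i) + D (Q i) y) with e' | e' <;>
    rw [e, e']
    · exact (min_le_left _ _).trans (by linarith)
    · exact (min_le_right _ _).trans (by linarith)
    · exact (min_le_right _ _).trans (by linarith)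
    · exact (min_le_left _ _).trans (by linarith)
  · rintro j a' b' heq heq'
    cases heq
    cases heq'
    exact min_le_left _ _

/-- With a single end, a path that leaves the piece must return where it left. -/
theorem IsGlueData.le_glueDist_of_eq (H : IsGlueData D h P Q p q) {i : I} (hpq : q i = p i)
    (a b : G i) : h i a b ≤ glueDist D h P Q p q (.inr ⟨i, a⟩) (.inr ⟨i, b⟩) := by
  refine le_glueDist (fun y => ?_) ?_
  · simp only [footDist, hpq]
    have e1 := (H.piece i).triangle a (p i) b
    rw [(H.piece i).symm (p i) b] at e1
    rw [min_add_add_left, min_add_add_left]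
    have : 0 ≤ min (D (P i) y) (D (Q i) y) := le_min (H.base.nonneg _ _) (H.base.nonneg _ _)
    linarith
  · rintro j a' b' heq heq'
    cases heq
    cases heq'
    exact le_rfl

/-- A sequence either visits `M` infinitely often, or visits one piece infinitely often, or runs
through pieces whose sizes tend to zero; in the last case it is shadowed by the attaching points in
`M`. -/
theorem IsGlueData.isSeqCompactDist (H : IsGlueData D h P Q p q) (hD : IsSeqCompactDist D)
    (hh : ∀ i, IsSeqCompactDist (h i)) {r : I → ℝ} (hr : ∀ i a b, h i a b ≤ r i)
    (hfin : ∀ η > 0, {i | η < r i}.Finite) : IsSeqCompactDist (glueDist D h P Q p q) := by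
  intro x
  by_cases hM : ∃ᶠ n in Filter.atTop, ∃ y, x n = .inl y
  · obtain ⟨φ, hφ, hx⟩ := Filter.extraction_of_frequently_atTop hM
    choose y hy using hx
    obtain ⟨a, ψ, hψ, ha⟩ := hD y
    refine ⟨.inl a, φ ∘ ψ, hφ.comp hψ, ?_⟩
    refine ha.congr fun n => ?_
    rw [Function.comp_apply, hy, H.glueDist_inl]
  by_cases hG : ∃ i, ∃ᶠ n in Filter.atTop, ∃ y : G i, x n = .inr ⟨i, y⟩
  · obtain ⟨i, hi⟩ := hG
    obtain ⟨φ, hφ, hx⟩ := Filter.extraction_of_frequently_atTop hi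
    choose y hy using hx
    obtain ⟨a, ψ, hψ, ha⟩ := hh i y
    refine ⟨.inr ⟨i, a⟩, φ ∘ ψ, hφ.comp hψ, ?_⟩
    refine squeeze_zero (fun n => H.isPseudoDist.nonneg _ _) (fun n => ?_) ha
    rw [Function.comp_apply, hy]
    exact H.glueDist_inr_le _ _ _
  push Not at hM hG
  obtain ⟨N, hN⟩ := Filter.eventually_atTop.1 hM
  have hx : ∀ n, ∃ i, ∃ y : G i, x (n + N) = .inr ⟨i, y⟩ := fun n => by
    rcases hz : x (n + N) with y | ⟨i, y⟩
    · exact (hN (n + N) (Nat.le_add_left _ _) y hz).elim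
    · exact ⟨i, y, rfl⟩
  choose i y hy using hx
  have hsmall : ∀ η > 0, ∀ᶠ n in Filter.atTop, r (i n) ≤ η := fun η hη => by
    have := (Filter.eventually_all_finite (hfin η hη)).2 fun j _ => hG j
    have := (Filter.tendsto_add_atTop_nat N).eventually this
    filter_upwards [this] with n hn
    by_contra hlt
    exact hn (i n) (not_le.1 hlt) (y n) (hy n)
  obtain ⟨a, ψ, hψ, ha⟩ := hD fun n => P (i n)
  refine ⟨.inl a, fun n => ψ n + N, fun m n hmn => Nat.add_lt_add_right (hψ hmn) N, ?_⟩
  have hr0 : Filter.Tendsto (fun n => r (i n)) Filter.atTop (nhds 0) := by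
    rw [Metric.tendsto_atTop']
    intro η hη
    obtain ⟨m, hm⟩ := Filter.eventually_atTop.1 (hsmall (η / 2) (half_pos hη))
    refine ⟨m, fun n hn => ?_⟩
    have h0 : 0 ≤ r (i n) := ((H.piece (i n)).nonneg (p _) (p _)).trans (hr _ _ _)
    rw [Real.dist_eq, sub_zero, abs_of_nonneg h0]
    linarith [hm n hn.le]
  have hsum := (hr0.comp hψ.tendsto_atTop).add ha
  rw [add_zero] at hsum
  refine squeeze_zero (fun n => H.isPseudoDist.nonneg _ _) (fun n => ?_) hsum
  rw [hy]
  refine (H.glueDist_le_foot _ _ (P (i (ψ n)))).trans ?_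
  simp only [footDist, Function.comp_apply]
  refine add_le_add ((min_le_left _ _).trans ?_) (H.base.symm _ _).le
  simpa [H.base.self] using hr _ (y (ψ n)) (p _)

/-- Curve fragments of the glued space can be examined in the pieces. -/
theorem IsGlueData.nullOver [Countable I] (H : IsGlueData D h P Q p q)
    {σ : M ⊕ (Σ i, G i) → M ⊕ (Σ i, G i) → ℝ}
    (hM : NullOver D fun x y => σ (.inl x) (.inl y))
    (hG : ∀ i, NullOver (h i) fun a b => σ (.inr ⟨i, a⟩) (.inr ⟨i, b⟩))
    (hpq : ∀ i, 0 < D (P i) (Q i) ∨ q i = p i) : NullOver (glueDist D h P Q p q) σ := by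
  classical
  intro K γ L hL F hF
  have hcover : (fun t => F (γ t)) '' K ⊆ (fun t => F (γ t)) '' {t ∈ K | ∃ y, γ t = .inl y} ∪
      ⋃ i, (fun t => F (γ t)) '' {t ∈ K | ∃ y : G i, γ t = .inr ⟨i, y⟩} := by
    rintro _ ⟨t, ht, rfl⟩
    rcases hz : γ t with y | ⟨i, y⟩
    · exact Or.inl ⟨t, ⟨ht, y, hz⟩, by simp [hz]⟩
    · exact Or.inr (mem_iUnion.2 ⟨i, t, ⟨ht, y, hz⟩, by simp [hz]⟩)
  refine measure_mono_null hcover (measure_union_null ?_ (measure_iUnion_null fun i => ?_))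
  · have : ∀ t, ∃ y, t ∈ {t ∈ K | ∃ y, γ t = .inl y} → γ t = .inl y := fun t => by
      by_cases ht : t ∈ {t ∈ K | ∃ y, γ t = .inl y}
      · exact ⟨ht.2.choose, fun _ => ht.2.choose_spec⟩
      · exact ⟨Classical.arbitrary M, fun h => (ht h).elim⟩
    choose γ' hγ' using this
    have h0 := hM {t ∈ K | ∃ y, γ t = .inl y} γ' L (fun s hs t ht => by
      have := hL s hs.1 t ht.1
      rwa [hγ' s hs, hγ' t ht, H.glueDist_inl] at this) (fun x => F (.inl x)) fun x y => hF _ _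
    rwa [image_congr fun t ht => show (fun t => F (γ t)) t = F (.inl (γ' t)) from
      congrArg F (hγ' t ht)]
  · have : ∀ t, ∃ y, t ∈ {t ∈ K | ∃ y : G i, γ t = .inr ⟨i, y⟩} → γ t = .inr ⟨i, y⟩ := fun t => by
      by_cases ht : t ∈ {t ∈ K | ∃ y : G i, γ t = .inr ⟨i, y⟩}
      · exact ⟨ht.2.choose, fun _ => ht.2.choose_spec⟩
      · exact ⟨p i, fun h => (ht h).elim⟩
    choose γ' hγ' using this
    rw [image_congr fun t ht => show (fun t => F (γ t)) t = F (.inr ⟨i, γ' t⟩) from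
      congrArg F (hγ' t ht)]
    rcases hpq i with hpos | heq
    · obtain ⟨δ, hδ, hLδ⟩ : ∃ δ > 0, L * δ < D (P i) (Q i) := by
        refine ⟨D (P i) (Q i) / (2 * (|L| + 1)), by positivity, ?_⟩
        rw [mul_div_assoc', div_lt_iff₀ (by positivity)]
        nlinarith [le_abs_self L, abs_nonneg L]
      have hK : ∀ K' : Set ℝ, K' = ⋃ n : ℤ, K' ∩ Ico (n • δ) ((n + 1) • δ) := fun K' => by
        rw [← inter_iUnion, iUnion_Ico_zsmul hδ, inter_univ]
      rw [hK {t ∈ K | ∃ y : G i, γ t = .inr ⟨i, y⟩}, image_iUnion]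
      refine measure_iUnion_null fun n => ?_
      refine hG i ({t ∈ K | ∃ y : G i, γ t = .inr ⟨i, y⟩} ∩ Ico (n • δ) ((n + 1) • δ)) γ' L
        (fun s hs t ht => ?_) (fun x => F (.inr ⟨i, x⟩)) fun x y => hF _ _
      have h1 := hL s hs.1.1 t ht.1.1
      rw [hγ' s hs.1, hγ' t ht.1] at h1
      have h2 := (H.min_le_glueDist i (γ' s) (γ' t)).trans h1
      rcases min_le_iff.1 h2 with h3 | h3
      · exact h3
      · have h4 : |s - t| ≤ δ := by
          have hs' := hs.2
          have ht' := ht.2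
          rw [add_smul, one_smul] at hs' ht'
          rw [abs_le]
          constructor <;> linarith [hs'.1, hs'.2, ht'.1, ht'.2]
        rcases le_or_gt 0 L with hL0 | hL0
        · linarith [mul_le_mul_of_nonneg_left h4 hL0]
        · linarith [mul_nonpos_of_nonpos_of_nonneg hL0.le (abs_nonneg (s - t))]
    · refine hG i {t ∈ K | ∃ y : G i, γ t = .inr ⟨i, y⟩} γ' L (fun s hs t ht => ?_) (fun x => F (.inr ⟨i, x⟩)) fun x y => hF _ _
      have h1 := hL s hs.1 t ht.1
      rw [hγ' s hs, hγ' t ht] at h1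
      exact (H.le_glueDist_of_eq heq _ _).trans h1

end Glue

/-! ### Local snowflakes have no curves -/

section Snow

/-- The distortion `t ↦ max t √(c t)`, which is the identity on `[c, ∞)`. -/
noncomputable def snow (c t : ℝ) : ℝ := max t √(c * t)

theorem le_snow (c t : ℝ) : t ≤ snow c t := le_max_left _ _

theorem snow_zero (c : ℝ) : snow c 0 = 0 := by simp [snow]

theorem snow_mono {c c' t t' : ℝ} (hc' : 0 ≤ c') (ht : 0 ≤ t) (h : c ≤ c') (h' : t ≤ t') :
    snow c t ≤ snow c' t' :=
  max_le_max h' (Real.sqrt_le_sqrt (mul_le_mul h h' ht hc'))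

theorem snow_eq {c t : ℝ} (hc : 0 ≤ c) (h : c ≤ t) : snow c t = t := by
  refine max_eq_left (Real.sqrt_le_iff.2 ⟨hc.trans h, ?_⟩)
  nlinarith

theorem snow_le {c t A : ℝ} (hc : 0 ≤ c) (ht : 0 ≤ t) (hcA : c ≤ A) (htA : t ≤ A) :
    snow c t ≤ A :=
  (snow_mono hc ht le_rfl htA).trans (snow_eq hc hcA).le

theorem snow_add_le {c s t : ℝ} (hc : 0 ≤ c) (hs : 0 ≤ s) (ht : 0 ≤ t) :
    snow c (s + t) ≤ snow c s + snow c t := by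
  refine max_le (add_le_add (le_snow _ _) (le_snow _ _)) ?_
  refine le_trans ?_ (add_le_add (le_max_right _ _) (le_max_right _ _))
  have h1 := Real.sqrt_nonneg (c * s)
  have h2 := Real.sqrt_nonneg (c * t)
  refine Real.sqrt_le_iff.2 ⟨by positivity, ?_⟩
  nlinarith [Real.sq_sqrt (mul_nonneg hc hs), Real.sq_sqrt (mul_nonneg hc ht), mul_nonneg h1 h2]

theorem continuous_snow (c : ℝ) : Continuous (snow c) := by unfold snow; fun_prop

variable {M : Type u} [MetricSpace M]

theorem isPseudoDist_snow {c : ℝ} (hc : 0 ≤ c) :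
    IsPseudoDist fun x y : M => snow c (dist x y) where
  self x := by rw [dist_self, snow_zero]
  symm x y := by rw [dist_comm]
  triangle x y z := (snow_mono hc dist_nonneg le_rfl (dist_triangle x y z)).trans
    (snow_add_le hc dist_nonneg dist_nonneg)

theorem isSeqCompactDist_snow [CompactSpace M] (c : ℝ) :
    IsSeqCompactDist fun x y : M => snow c (dist x y) := fun x => by
  obtain ⟨a, φ, hφ, ha⟩ := isSeqCompactDist_dist M x
  refine ⟨a, φ, hφ, ?_⟩
  have := ((continuous_snow c).tendsto 0).comp ha
  rwa [snow_zero] at this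

theorem abs_sqrt_sub_sqrt_le {a b m : ℝ} (hm : 0 < m) (ha : m ≤ a) (hb : m ≤ b) :
    |√a - √b| ≤ (√m)⁻¹ * |a - b| := by
  have hm' : 0 < √m := Real.sqrt_pos.2 hm
  rw [le_inv_mul_iff₀ hm']
  have h1 : a - b = (√a + √b) * (√a - √b) := by
    nlinarith [Real.sq_sqrt (hm.le.trans ha), Real.sq_sqrt (hm.le.trans hb)]
  rw [h1, abs_mul, abs_of_nonneg (by positivity : 0 ≤ √a + √b)]
  refine mul_le_mul_of_nonneg_right ?_ (abs_nonneg _)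
  linarith [Real.sqrt_le_sqrt ha, Real.sqrt_nonneg b]

theorem abs_snow_sub_snow_le {c a b m : ℝ} (hc : 0 < c) (hm : 0 < m) (ha : m ≤ a) (hb : m ≤ b) :
    |snow c a - snow c b| ≤ (1 + (√(c * m))⁻¹ * c) * |a - b| := by
  have h1 := abs_sqrt_sub_sqrt_le (mul_pos hc hm) (mul_le_mul_of_nonneg_left ha hc.le)
    (mul_le_mul_of_nonneg_left hb hc.le)
  rw [← mul_sub, abs_mul, abs_of_pos hc, ← mul_assoc] at h1
  have h2 : 0 ≤ (√(c * m))⁻¹ * c := by positivity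
  refine (abs_max_sub_max_le_max _ _ _ _).trans (max_le ?_ (h1.trans ?_))
  · nlinarith [abs_nonneg (a - b)]
  · nlinarith [abs_nonneg (a - b)]

/-- A Lipschitz bound on `√(c d)` along a fragment makes `d` at most quadratic in the parameter, so
Lipschitz functions of `d` have null images. -/
theorem curveFlatDist_snow {c : ℝ} (hc : 0 < c) :
    curveFlatDist (fun x y : M => snow c (dist x y)) = fun x y => snow c (dist x y) := by
  have hρ := isPseudoDist_snow (M := M) hc.le
  refine curveFlatDist_eq_of_dist_isCurveFlat hρ fun p =>
    ⟨⟨1, fun x y => by simpa using hρ.abs_sub_le p x y⟩, ?_⟩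
  rintro K γ ⟨-, L, hL⟩
  rw [hausdorffMeasure_real]
  have hsq : ∀ s ∈ K, ∀ t ∈ K, dist (γ s) (γ t) ≤ L ^ 2 / c * |s - t| ^ 2 := by
    intro s hs t ht
    have h1 := (le_max_right _ _).trans (hL s hs t ht)
    have h2 := Real.sqrt_le_iff.1 h1
    rw [div_mul_eq_mul_div, le_div_iff₀ hc]
    nlinarith [h2.2]
  -- The square root is Lipschitz only away from zero, hence the countable cover by sets on which
  -- the distance to `p` is bounded below.
  have hcover : (fun t => snow c (dist p (γ t))) '' K ⊆
      {0} ∪ ⋃ n : ℕ, (fun t => snow c (dist p (γ t))) ''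
        {t ∈ K | 1 / ((n : ℝ) + 1) ≤ dist p (γ t)} := by
    rintro _ ⟨t, ht, rfl⟩
    rcases (dist_nonneg (x := p) (y := γ t)).eq_or_lt with h | h
    · left
      simp only [← h, snow_zero, mem_singleton_iff]
    · obtain ⟨n, hn⟩ := exists_nat_one_div_lt h
      exact Or.inr (mem_iUnion.2 ⟨n, t, ⟨ht, hn.le⟩, rfl⟩)
  refine measure_mono_null hcover (measure_union_null (by simp) (measure_iUnion_null fun n => ?_))
  have hm : 0 < 1 / ((n : ℝ) + 1) := by positivity
  refine volume_image_eq_zero_of_sq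
    (C := (1 + (√(c * (1 / ((n : ℝ) + 1))))⁻¹ * c) * (L ^ 2 / c)) fun s hs t ht => ?_
  refine (abs_snow_sub_snow_le hc hm hs.2 ht.2).trans ?_
  rw [mul_assoc]
  refine mul_le_mul_of_nonneg_left ?_ (by positivity)
  refine le_trans ?_ (hsq s hs.1 t ht.1)
  have := (isPseudoDist_dist M).abs_sub_le p (γ s) (γ t)
  exact this

theorem nullOver_snow [CompactSpace M] {c : ℝ} (hc : 0 < c) :
    NullOver (fun x y : M => snow c (dist x y)) fun x y => snow c (dist x y) := by
  have := (isSeqCompactDist_snow (M := M) c).nullOver_curveFlatDist (isPseudoDist_snow hc.le)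
  rwa [curveFlatDist_snow hc] at this

end Snow

/-! ### Recovering a metric from its small and large scales -/

section Exact

/-- Pseudometrics that are dominated by the metric of `M` asymptotically at small scales, and at
scales at least `c`, are dominated by it everywhere. -/
def IsExact (M : Type u) [MetricSpace M] (c : ℝ) : Prop :=
  ∀ σ : M → M → ℝ, IsPseudoDist σ → (∀ x y, c ≤ dist x y → σ x y ≤ dist x y) →
    (∀ η > 0, ∃ δ > 0, ∀ x y, dist x y ≤ δ → σ x y ≤ (1 + η) * dist x y) →
      ∀ x y, σ x y ≤ dist x y

variable {M : Type u} [MetricSpace M]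

theorem IsExact.mono {c c' : ℝ} (h : IsExact M c) (hc : c' ≤ c) : IsExact M c' :=
  fun σ hσ h1 h2 => h σ hσ (fun x y hxy => h1 x y (hc.trans hxy)) h2

theorem IsPseudoDist.le_sum {X : Type u} {σ : X → X → ℝ} (hσ : IsPseudoDist σ) (u : ℕ → X)
    (n : ℕ) : σ (u 0) (u n) ≤ ∑ i ∈ Finset.range n, σ (u i) (u (i + 1)) := by
  induction n with
  | zero => simp [hσ.self]
  | succ n ih =>
    rw [Finset.sum_range_succ]
    exact (hσ.triangle _ (u n) _).trans (add_le_add ih le_rfl)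

/-- Subdivide the curve so finely that the local bound applies to each step. The steps sum to at
most its length, which is the distance; then let `η` tend to zero. -/
theorem le_dist_of_curve {σ : M → M → ℝ} (hσ : IsPseudoDist σ)
    (hloc : ∀ η > 0, ∃ δ > 0, ∀ x y, dist x y ≤ δ → σ x y ≤ (1 + η) * dist x y) {a b : ℝ}
    (hab : a ≤ b) {γ : ℝ → M} (hγ : ContinuousOn γ (Icc a b))
    (hvar : eVariationOn γ (Icc a b) ≤ edist (γ a) (γ b)) :
    σ (γ a) (γ b) ≤ dist (γ a) (γ b) := by
  have key : ∀ η > 0, σ (γ a) (γ b) ≤ (1 + η) * dist (γ a) (γ b) := by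
    intro η hη
    obtain ⟨δ, hδ, hσδ⟩ := hloc η hη
    obtain ⟨δ', hδ', hγδ⟩ := Metric.uniformContinuousOn_iff_le.1
      (isCompact_Icc.uniformContinuousOn_of_continuous hγ) δ hδ
    obtain ⟨n, hn⟩ := exists_nat_gt ((b - a) / δ')
    have hn0 : (0 : ℝ) < n := lt_of_le_of_lt (div_nonneg (by linarith) hδ'.le) hn
    -- Truncating at `b` makes the partition a monotone sequence on all of `ℕ` with values in `Icc a
    -- b`, as `eVariationOn.sum_le` requires.
    set t : ℕ → ℝ := fun i => min b (a + i * ((b - a) / n)) with ht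
    have hstep : 0 ≤ (b - a) / n := div_nonneg (by linarith) hn0.le
    have htmono : Monotone t := fun i j hij => min_le_min le_rfl (by
      have : (i : ℝ) ≤ j := by exact_mod_cast hij
      nlinarith)
    have ht0 : t 0 = a := by simp [ht, hab]
    have htn : t n = b := by
      simp only [ht]
      rw [mul_div_cancel₀ _ hn0.ne']
      simp
    have htmem : ∀ i, t i ∈ Icc a b := fun i =>
      ⟨le_min hab (by nlinarith [(Nat.cast_nonneg i : (0 : ℝ) ≤ i)]), min_le_left _ _⟩
    have htd : ∀ i, dist (t i) (t (i + 1)) ≤ δ' := fun i => by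
      refine (abs_min_sub_min_le_max _ _ _ _).trans ?_
      rw [sub_self, abs_zero]
      refine max_le hδ'.le ?_
      push_cast
      rw [show a + i * ((b - a) / n) - (a + (i + 1) * ((b - a) / n)) = -((b - a) / n) by ring,
        abs_neg, abs_of_nonneg hstep, div_le_iff₀ hn0]
      rw [div_lt_iff₀ hδ'] at hn
      linarith
    have h1 := hσ.le_sum (fun i => γ (t i)) n
    have h2 : ∑ i ∈ Finset.range n, edist (γ (t (i + 1))) (γ (t i)) ≤ edist (γ a) (γ b) :=
      (eVariationOn.sum_le htmono htmem).trans hvar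
    have h3 : ∑ i ∈ Finset.range n, dist (γ (t i)) (γ (t (i + 1))) ≤ dist (γ a) (γ b) := by
      simp only [edist_dist] at h2
      rw [← ENNReal.ofReal_sum_of_nonneg (fun i _ => dist_nonneg),
        ENNReal.ofReal_le_ofReal_iff dist_nonneg] at h2
      simpa only [dist_comm] using h2
    simp only [ht0, htn] at h1
    calc σ (γ a) (γ b) ≤ ∑ i ∈ Finset.range n, σ (γ (t i)) (γ (t (i + 1))) := h1
      _ ≤ ∑ i ∈ Finset.range n, (1 + η) * dist (γ (t i)) (γ (t (i + 1))) :=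
        Finset.sum_le_sum fun i _ => hσδ _ _ (hγδ _ (htmem i) _ (htmem (i + 1)) (htd i))
      _ = (1 + η) * ∑ i ∈ Finset.range n, dist (γ (t i)) (γ (t (i + 1))) :=
        (Finset.mul_sum _ _ _).symm
      _ ≤ (1 + η) * dist (γ a) (γ b) := mul_le_mul_of_nonneg_left h3 (by linarith)
  refine le_of_forall_pos_le_add fun e he => ?_
  refine (key (e / (dist (γ a) (γ b) + 1)) (by positivity)).trans ?_
  rw [add_mul, one_mul, div_mul_eq_mul_div]
  refine add_le_add le_rfl ((div_le_iff₀ (by positivity)).2 ?_)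
  nlinarith [dist_nonneg (x := γ a) (y := γ b)]

theorem IsGeodesicSpace.isExact (h : IsGeodesicSpace M) (c : ℝ) : IsExact M c := by
  intro σ hσ _ hloc x y
  rcases eq_or_ne x y with rfl | hxy
  · rw [hσ.self, dist_self]
  · obtain ⟨a, b, γ, hab, hγ, rfl, rfl, hv⟩ := h x y hxy
    exact le_dist_of_curve hσ hloc hab hγ hv.le

theorem Finite.exists_isExact [Finite M] : ∃ c > 0, IsExact M c := by
  obtain ⟨c, hc, hsep⟩ : ∃ c > 0, ∀ x y : M, x ≠ y → c ≤ dist x y := by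
    classical
    rcases isEmpty_or_nonempty M with hM | hM
    · exact ⟨1, one_pos, fun x => (hM.elim x)⟩
    obtain ⟨p, hp⟩ := Finite.exists_min
      fun p : M × M => if p.1 = p.2 then (1 : ℝ) else dist p.1 p.2
    refine ⟨_, ?_, fun x y hxy => (hp (x, y)).trans (by simp [hxy])⟩
    by_cases h : p.1 = p.2
    · simp [h]
    · simp [h]
  refine ⟨c, hc, fun σ hσ h1 _ x y => ?_⟩
  rcases eq_or_ne x y with rfl | hxy
  · rw [hσ.self, dist_self]
  · exact h1 x y (hsep x y hxy)

theorem le_dist_of_Icc_subset {S : Set ℝ} {σ : S → S → ℝ} (hσ : IsPseudoDist σ)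
    (hloc : ∀ η > 0, ∃ δ > 0, ∀ x y, dist x y ≤ δ → σ x y ≤ (1 + η) * dist x y) {x y : S}
    (hxy : x.1 ≤ y.1) (hS : Icc x.1 y.1 ⊆ S) : σ x y ≤ dist x y := by
  classical
  set γ : ℝ → S := fun t => if h : t ∈ Icc x.1 y.1 then ⟨t, hS h⟩ else x with hγ
  have hval : ∀ t ∈ Icc x.1 y.1, (γ t : ℝ) = t := fun t ht => by simp only [hγ, dif_pos ht]
  have hx : γ x.1 = x := Subtype.ext (hval _ (left_mem_Icc.2 hxy))
  have hy : γ y.1 = y := Subtype.ext (hval _ (right_mem_Icc.2 hxy))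
  have hcont : ContinuousOn γ (Icc x.1 y.1) := by
    rw [Topology.IsInducing.subtypeVal.continuousOn_iff]
    exact continuousOn_id.congr hval
  have hvar : eVariationOn γ (Icc x.1 y.1) ≤ edist (γ x.1) (γ y.1) := by
    have h1 : eVariationOn γ (Icc x.1 y.1) = eVariationOn (fun t => (γ t : ℝ)) (Icc x.1 y.1) := rfl
    rw [h1, eVariationOn.eq_of_eqOn (f' := id) hval]
    have h2 := (monotone_id.monotoneOn (Icc x.1 y.1)).eVariationOn_eq (left_mem_Icc.2 hxy)
      (right_mem_Icc.2 hxy)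
    rw [inter_self] at h2
    refine h2.le.trans ?_
    rw [hx, hy, edist_dist, Subtype.dist_eq, Real.dist_eq, abs_sub_comm]
    exact ENNReal.ofReal_le_ofReal (le_abs_self _)
  have := le_dist_of_curve hσ hloc hxy hcont hvar
  rwa [hx, hy] at this

theorem isExact_Icc (a b c : ℝ) : IsExact (Icc a b) c := by
  intro σ hσ _ hloc x y
  rcases le_total x.1 y.1 with h | h
  · exact le_dist_of_Icc_subset hσ hloc h (Icc_subset_Icc x.2.1 y.2.2)
  · rw [hσ.symm, dist_comm]
    exact le_dist_of_Icc_subset hσ hloc h (Icc_subset_Icc y.2.1 x.2.2)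

/-- Points on opposite sides of the gap are at distance at least `a`, where the bound is assumed;
points on the same side are joined by an interval. -/
theorem isExact_gappedSegment {a : ℝ} (ha : 0 < a) (w : ℝ) :
    IsExact (gappedSegment a w) a := by
  intro σ hσ hfar hloc x y
  wlog hxy : x.1 ≤ y.1 generalizing x y
  · rw [hσ.symm, dist_comm]
    exact this y x (le_of_not_ge hxy)
  rcases x.2 with hx | hx <;> rcases y.2 with hy | hy
  · exact le_dist_of_Icc_subset hσ hloc hxy
      ((Icc_subset_Icc hx.1 hy.2).trans subset_union_left)
  · refine hfar x y ?_
    rw [Subtype.dist_eq, Real.dist_eq, abs_sub_comm, abs_of_nonneg (by linarith)]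
    linarith [hx.2, hy.1]
  · linarith [hx.1, hy.2]
  · exact le_dist_of_Icc_subset hσ hloc hxy
      ((Icc_subset_Icc hx.1 hy.2).trans subset_union_right)

theorem IsExact.of_isometryEquiv {N : Type v} [MetricSpace N] {c : ℝ} (h : IsExact N c)
    (e : M ≃ᵢ N) : IsExact M c := by
  intro σ hσ h1 h2 x y
  have := h (fun x y => σ (e.symm x) (e.symm y)) (hσ.comp _)
    (fun x y hxy => by
      have := h1 (e.symm x) (e.symm y) (by rwa [e.symm.dist_eq])
      rwa [e.symm.dist_eq] at this)
    (fun η hη => by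
      obtain ⟨δ, hδ, H⟩ := h2 η hη
      refine ⟨δ, hδ, fun x y hxy => ?_⟩
      have := H (e.symm x) (e.symm y) (by rwa [e.symm.dist_eq])
      rwa [e.symm.dist_eq] at this) (e x) (e y)
  simpa [e.dist_eq] using this

theorem IsGappedSegment.exists_isExact (h : IsGappedSegment M) : ∃ c > 0, IsExact M c := by
  obtain ⟨a, ω, ha, -, -, ⟨e⟩⟩ := h
  exact ⟨a, ha, (isExact_gappedSegment ha (ω a)).of_isometryEquiv e⟩

/-- Finitely many pairs of points at each scale such that shortening the distorted metric along
these pairs recovers the metric up to a factor close to `1`, and asymptotically `1`. -/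
theorem exists_pairs (M : Type u) [MetricSpace M] [CompactSpace M] [Nonempty M] {c ε : ℝ}
    (hc : 0 < c) (hε : 0 < ε) : ∃ T : ℕ → Set (M × M), (∀ k, (T k).Finite) ∧
      (∀ k, ∃ x, (x, x) ∈ T k) ∧ (∀ k, ∀ p ∈ T k, dist p.1 p.2 ≤ 2 * (c * (1 / 2) ^ k)) ∧
      ∀ σ : M → M → ℝ, IsPseudoDist σ → (∀ x y, σ x y ≤ snow c (dist x y)) →
        (∀ k, ∀ p ∈ T k, σ p.1 p.2 ≤ dist p.1 p.2) →
        (∀ x y, σ x y ≤ (1 + ε) * dist x y) ∧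
        ∀ η > 0, ∃ δ > 0, ∀ x y, dist x y ≤ δ → σ x y ≤ (1 + η) * dist x y := by
  -- The mesh of the net at scale `c / 2^k`. The first bound keeps the net points near such a pair
  -- within twice the scale. In the second, two terms `snow c δ` pay for moving the endpoints, and
  -- two more dominate the increase `2 δ` of their distance.
  have hδ : ∀ k : ℕ, ∃ δ > 0, 2 * δ ≤ c * (1 / 2) ^ k ∧
      4 * snow c δ ≤ ε * (1 / 2) ^ k * (c * (1 / 2) ^ (k + 1)) := by
    intro k
    have h1 : ∀ᶠ δ in nhds (0 : ℝ), snow c δ < ε * (1 / 2) ^ k * (c * (1 / 2) ^ (k + 1)) / 4 := by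
      have := (continuous_snow c).tendsto 0
      rw [snow_zero] at this
      exact this.eventually (gt_mem_nhds (by positivity))
    have h2 : ∀ᶠ δ in nhds (0 : ℝ), δ < c * (1 / 2) ^ k / 2 := gt_mem_nhds (by positivity)
    obtain ⟨δ, ⟨h3, h4⟩, h5⟩ := (((h1.and h2).filter_mono nhdsWithin_le_nhds).and
      (self_mem_nhdsWithin (s := Ioi (0 : ℝ)))).exists
    exact ⟨δ, h5, by linarith, by linarith⟩
  choose δ hδ0 hδ1 hδ2 using hδ
  have hN : ∀ k : ℕ, ∃ N : Set M, N.Finite ∧ ∀ x, ∃ y ∈ N, dist x y < δ k := fun k => by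
    obtain ⟨N, -, hN, hcov⟩ := finite_cover_balls_of_compact
      (isCompact_univ (X := M)) (hδ0 k)
    refine ⟨N, hN, fun x => ?_⟩
    obtain ⟨y, hy, hxy⟩ := mem_iUnion₂.1 (hcov (mem_univ x))
    exact ⟨y, hy, hxy⟩
  choose N hNfin hN using hN
  refine ⟨fun k => {p ∈ N k ×ˢ N k | dist p.1 p.2 ≤ 2 * (c * (1 / 2) ^ k)},
    fun k => ((hNfin k).prod (hNfin k)).subset (sep_subset _ _), fun k => ?_,
    fun k p hp => hp.2, fun σ hσ hsnow hT => ?_⟩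
  · obtain ⟨x, hx, -⟩ := hN k (Classical.arbitrary M)
    exact ⟨x, ⟨hx, hx⟩, by rw [dist_self]; positivity⟩
  have key : ∀ k, ∀ x y : M, c * (1 / 2) ^ (k + 1) < dist x y → dist x y ≤ c * (1 / 2) ^ k →
      σ x y ≤ (1 + ε * (1 / 2) ^ k) * dist x y := by
    intro k x y h1 h2
    obtain ⟨p, hp, hxp⟩ := hN k x
    obtain ⟨q, hq, hyq⟩ := hN k y
    have h3 : dist p q ≤ dist x y + 2 * δ k := by
      have e1 := dist_triangle p x q
      have e2 := dist_triangle x y q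
      rw [dist_comm p x] at e1
      linarith
    have h4 := hT k (p, q) ⟨⟨hp, hq⟩, by linarith [hδ1 k]⟩
    have h5 : ∀ u v : M, dist u v < δ k → σ u v ≤ snow c (δ k) := fun u v huv =>
      (hsnow u v).trans (snow_mono hc.le dist_nonneg le_rfl huv.le)
    have h6 := h5 x p hxp
    have h7 := h5 y q hyq
    rw [hσ.symm] at h7
    have h8 := hσ.triangle x p y
    have h9 := hσ.triangle p q y
    have h10 := le_snow c (δ k)
    have h11 : ε * (1 / 2) ^ k * (c * (1 / 2) ^ (k + 1)) ≤ ε * (1 / 2) ^ k * dist x y :=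
      mul_le_mul_of_nonneg_left h1.le (by positivity)
    have := hδ2 k
    simp only at h4
    linarith
  have near : ∀ x y : M, 0 < dist x y → dist x y ≤ c → ∃ k : ℕ,
      c * (1 / 2) ^ (k + 1) < dist x y ∧ dist x y ≤ c * (1 / 2) ^ k := by
    intro x y h0 h1
    obtain ⟨k, hk1, hk2⟩ := exists_nat_pow_near_of_lt_one (div_pos h0 hc) ((div_le_one hc).2 h1)
      (y := 1 / 2) (by norm_num) (by norm_num)
    rw [lt_div_iff₀ hc] at hk1
    rw [div_le_iff₀ hc] at hk2
    exact ⟨k, by linarith, by linarith⟩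
  constructor
  · intro x y
    rcases (dist_nonneg (x := x) (y := y)).eq_or_lt with h0 | h0
    · rw [dist_eq_zero.1 h0.symm, hσ.self, dist_self, mul_zero]
    rcases le_total (dist x y) c with h1 | h1
    · obtain ⟨k, hk1, hk2⟩ := near x y h0 h1
      refine (key k x y hk1 hk2).trans (mul_le_mul_of_nonneg_right ?_ h0.le)
      have : ε * (1 / 2) ^ k ≤ ε * 1 :=
        mul_le_mul_of_nonneg_left (pow_le_one₀ (by norm_num) (by norm_num)) hε.le
      linarith
    · refine (hsnow x y).trans ?_
      rw [snow_eq hc.le h1]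
      nlinarith
  · intro η hη
    obtain ⟨m, hm⟩ := exists_pow_lt_of_lt_one (div_pos hη hε) (by norm_num : (1 / 2 : ℝ) < 1)
    rw [lt_div_iff₀ hε] at hm
    have hc1 : (1 / 2 : ℝ) ^ m ≤ 1 := pow_le_one₀ (by norm_num) (by norm_num)
    refine ⟨c * (1 / 2) ^ m, by positivity, fun x y hxy => ?_⟩
    rcases (dist_nonneg (x := x) (y := y)).eq_or_lt with h0 | h0
    · rw [dist_eq_zero.1 h0.symm, hσ.self, dist_self, mul_zero]
    obtain ⟨k, hk1, hk2⟩ := near x y h0 (hxy.trans (by nlinarith))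
    refine (key k x y hk1 hk2).trans (mul_le_mul_of_nonneg_right ?_ h0.le)
    have hmk : m ≤ k := by
      have h1 := lt_of_mul_lt_mul_left (hk1.trans_le hxy) hc.le
      have h2 := (pow_lt_pow_iff_right_of_lt_one₀ (by norm_num) (by norm_num)).1 h1
      omega
    have : (1 / 2 : ℝ) ^ k ≤ (1 / 2) ^ m :=
      pow_le_pow_of_le_one (by norm_num) (by norm_num) hmk
    nlinarith

end Exact

/-! ### Collapses and the gadgets made from them -/

section Gadget

/-- `(Z, ρ)` is a space whose curve-flat quotient of order `α` is `M`, up to a factor `1 + ε`. -/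
structure IsCollapse (M : Type u) [MetricSpace M] (α : Ordinal.{0}) (A ε : ℝ) {Z : Type u}
    (ρ : Z → Z → ℝ) (ι : M → Z) (π : Z → M) : Prop where
  pseudo : IsPseudoDist ρ
  compact : IsSeqCompactDist ρ
  size : ∀ z w, ρ z w ≤ 2 * A
  left_inv : ∀ x, π (ι x) = x
  le_iter : ∀ z w, dist (π z) (π w) ≤ iterCurveFlatDist ρ α z w
  total : ∀ z, iterCurveFlatDist ρ α z (ι (π z)) = 0
  iter_le : ∀ x y, iterCurveFlatDist ρ α (ι x) (ι y) ≤ (1 + ε) * dist x y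
  eq_of_diam : ∀ x y, dist x y = A → ρ (ι x) (ι y) = A
  strict : ∀ β < α, ∃ z w, iterCurveFlatDist ρ α z w < iterCurveFlatDist ρ β z w
  exact : (∃ c > 0, IsExact M c) → ∀ x y, iterCurveFlatDist ρ α (ι x) (ι y) ≤ dist x y

/-- Every compact metric space is, almost isometrically, a curve-flat quotient of order `α`. -/
def Collapsible (α : Ordinal.{0}) : Prop :=
  ∀ (M : Type u) [MetricSpace M] [CompactSpace M] [Nonempty M] (A ε : ℝ), 0 < A → 0 < ε →
    (∀ x y : M, dist x y ≤ A) →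
    ∃ (Z : Type u) (ρ : Z → Z → ℝ) (ι : M → Z) (π : Z → M), IsCollapse M α A ε ρ ι π

theorem collapsible_zero : Collapsible.{u} 0 := by
  intro M _ _ _ A ε hA hε hMA
  refine ⟨M, dist, id, id, isPseudoDist_dist M, isSeqCompactDist_dist M, fun z w => ?_,
    fun _ => rfl, fun z w => ?_, fun z => ?_, fun x y => ?_, fun x y h => h,
    fun β hβ => absurd hβ not_lt_zero, fun _ x y => ?_⟩
  · linarith [hMA z w]
  all_goals rw [iterCurveFlatDist_zero]
  · rfl
  · exact dist_self z
  · simp only [id]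
    nlinarith [dist_nonneg (x := x) (y := y)]
  · rfl

/-- A compact space whose curve-flat quotient of order `b + 1` consists of the two points `p`, `q`
at distance `a`, or of the single point `p`. -/
structure Gadget (b : Ordinal.{0}) where
  G : Type
  g : G → G → ℝ
  p : G
  q : G
  far : Set G
  a : ℝ
  pseudo : IsPseudoDist g
  compact : IsSeqCompactDist g
  a_pos : 0 < a
  gap : ∀ z ∉ far, ∀ w ∈ far, a ≤ iterCurveFlatDist g b z w
  p_notMem : p ∉ far
  near : ∀ z ∉ far, iterCurveFlatDist g (b + 1) z p = 0
  far_q : ∀ z ∈ far, iterCurveFlatDist g (b + 1) z q = 0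
  width : g p q ≤ iterCurveFlatDist g b p q
  jump : iterCurveFlatDist g (b + 1) p q ≤ a

theorem isCompact_gappedSegment (a w : ℝ) : IsCompact (gappedSegment a w) :=
  isCompact_Icc.union isCompact_Icc

/-- By exactness `ι` is `1`-Lipschitz at stage `b`, so an interval in `S` becomes a Lipschitz curve
there, which the next stage crushes. -/
theorem IsCollapse.iter_add_one_segment {S : Set ℝ} {b : Ordinal.{0}} {A ε : ℝ} {Z : Type}
    {ρ : Z → Z → ℝ} {ι : S → Z} {π : Z → S} (h : IsCollapse S b A ε ρ ι π)
    (hS : ∃ c > 0, IsExact S c) {s t : ℝ} (hst : Icc s t ⊆ S) (x y : S) (hx : x.1 ∈ Icc s t)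
    (hy : y.1 ∈ Icc s t) : iterCurveFlatDist ρ (b + 1) (ι x) (ι y) = 0 := by
  classical
  rw [iterCurveFlatDist_add_one]
  set γ : ℝ → S := fun r => if hr : r ∈ Icc s t then ⟨r, hst hr⟩ else x with hγ
  have hval : ∀ r ∈ Icc s t, (γ r : ℝ) = r := fun r hr => by simp only [hγ, dif_pos hr]
  have h1 := curveFlatDist_eq_zero_of_curve (h.pseudo.iter b) (γ := fun r => ι (γ r)) (L := 1)
    (a := s) (b := t) (fun r hr r' hr' => by
      refine (h.exact hS _ _).trans ?_
      rw [Subtype.dist_eq, hval r hr, hval r' hr', Real.dist_eq, one_mul]) hx hy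
  have ex : γ x.1 = x := Subtype.ext (hval _ hx)
  have ey : γ y.1 = y := Subtype.ext (hval _ hy)
  simpa only [ex, ey] using h1

theorem exists_gadget {b : Ordinal.{0}} (hb : Collapsible.{0} b) {a w : ℝ} (ha : 0 < a)
    (haw : a ≤ w) : ∃ Γ : Gadget b, Γ.g Γ.p Γ.q = w ∧ Γ.a = a ∧ Γ.q ∈ Γ.far ∧
      ∀ z z', Γ.g z z' ≤ 2 * w := by
  have hcS : CompactSpace (gappedSegment a w) :=
    isCompact_iff_compactSpace.1 (isCompact_gappedSegment a w)
  have hw : 0 < w := ha.trans_le haw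
  have h0 : (0 : ℝ) ∈ gappedSegment a w := Or.inl ⟨le_rfl, by linarith⟩
  have hu : (w - a) / 2 ∈ gappedSegment a w := Or.inl ⟨by linarith, le_rfl⟩
  have hv : (w + a) / 2 ∈ gappedSegment a w := Or.inr ⟨le_rfl, by linarith⟩
  have hww : w ∈ gappedSegment a w := Or.inr ⟨by linarith, le_rfl⟩
  have : Nonempty (gappedSegment a w) := ⟨⟨0, h0⟩⟩
  have hrange : ∀ x : gappedSegment a w, 0 ≤ x.1 ∧ x.1 ≤ w := by
    rintro ⟨x, hx | hx⟩
    · exact ⟨hx.1, by linarith [hx.2]⟩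
    · exact ⟨by linarith [hx.1], hx.2⟩
  have hleft : ∀ x : gappedSegment a w, ¬ (w - a) / 2 < x.1 → x.1 ∈ Icc 0 ((w - a) / 2) :=
    fun x hx => ⟨(hrange x).1, not_lt.1 hx⟩
  have hright : ∀ x : gappedSegment a w, (w - a) / 2 < x.1 → x.1 ∈ Icc ((w + a) / 2) w := by
    rintro ⟨x, hx | hx⟩ h
    · exact absurd hx.2 (not_le.2 h)
    · exact hx
  -- The error `1` is arbitrary: gapped segments are exact, so it plays no role.
  obtain ⟨Z, ρ, ι, π, H⟩ := hb (gappedSegment a w) w 1 hw one_pos fun x y => by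
    rw [Subtype.dist_eq, Real.dist_eq, abs_le]
    constructor <;> linarith [(hrange x).1, (hrange x).2, (hrange y).1, (hrange y).2]
  have hex : ∃ c > 0, IsExact (gappedSegment a w) c := ⟨a, ha, isExact_gappedSegment ha w⟩
  have hd : dist (⟨0, h0⟩ : gappedSegment a w) ⟨w, hww⟩ = w := by
    rw [Subtype.dist_eq, Real.dist_eq, zero_sub, abs_neg, abs_of_pos hw]
  have hg : ρ (ι ⟨0, h0⟩) (ι ⟨w, hww⟩) = w := H.eq_of_diam _ _ hd
  have htot : ∀ z, iterCurveFlatDist ρ (b + 1) z (ι (π z)) ≤ 0 := fun z =>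
    (H.pseudo.iter_anti (Order.le_succ b) _ _).trans (H.total z).le
  have h1 := H.pseudo.iter (b + 1)
  refine ⟨{
    G := Z
    g := ρ
    p := ι ⟨0, h0⟩
    q := ι ⟨w, hww⟩
    far := {z | (w - a) / 2 < (π z).1}
    a := a
    pseudo := H.pseudo
    compact := H.compact
    a_pos := ha
    gap := fun z hz z' hz' => ?_
    p_notMem := ?_
    near := fun z hz => ?_
    far_q := fun z hz => ?_
    width := ?_
    jump := ?_ }, hg, rfl, ?_, H.size⟩
  · refine le_trans ?_ (H.le_iter z z')
    have e1 := hleft _ hz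
    have e2 := hright _ hz'
    rw [Subtype.dist_eq, Real.dist_eq, abs_sub_comm]
    exact le_trans (by linarith [e1.2, e2.1]) (le_abs_self _)
  · simp only [mem_ofPred_eq, H.left_inv]
    linarith
  · have e := H.iter_add_one_segment hex subset_union_left (π z) ⟨0, h0⟩ (hleft _ hz)
      ⟨le_rfl, by linarith⟩
    refine le_antisymm ((h1.triangle _ (ι (π z)) _).trans ?_) (h1.nonneg _ _)
    linarith [htot z]
  · have e := H.iter_add_one_segment hex subset_union_right (π z) ⟨w, hww⟩ (hright _ hz)
      ⟨by linarith, le_rfl⟩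
    refine le_antisymm ((h1.triangle _ (ι (π z)) _).trans ?_) (h1.nonneg _ _)
    linarith [htot z]
  · rw [hg]
    have := H.le_iter (ι ⟨0, h0⟩) (ι ⟨w, hww⟩)
    rwa [H.left_inv, H.left_inv, hd] at this
  -- Both solid parts have been crushed, so only the gap of length `a` contributes on the way from
  -- `p` to `q`.
  · have e1 := H.iter_add_one_segment hex subset_union_left ⟨0, h0⟩ ⟨_, hu⟩
      ⟨le_rfl, by linarith⟩ ⟨by linarith, le_rfl⟩
    have e2 := H.iter_add_one_segment hex subset_union_right ⟨_, hv⟩ ⟨w, hww⟩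
      ⟨le_rfl, by linarith⟩ ⟨by linarith, le_rfl⟩
    have e3 := (H.pseudo.iter_anti (Order.le_succ b) (ι ⟨_, hu⟩) (ι ⟨_, hv⟩)).trans
      (H.exact hex _ _)
    rw [Subtype.dist_eq, Real.dist_eq, abs_sub_comm, abs_of_nonneg (by linarith)] at e3
    have e4 := h1.triangle (ι ⟨0, h0⟩) (ι ⟨_, hu⟩) (ι ⟨w, hww⟩)
    have e5 := h1.triangle (ι ⟨_, hu⟩) (ι ⟨_, hv⟩) (ι ⟨w, hww⟩)
    rw [Order.succ_eq_add_one] at e3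
    linarith
  · simp only [mem_ofPred_eq, H.left_inv]
    linarith

/-- The collapse of an interval, attached at one end: it is an interval of length `s` at stage `b`
and a point at stage `b + 1`. Hairs witness that stages before `α` are not final. -/
theorem exists_hair {b : Ordinal.{0}} (hb : Collapsible.{0} b) {s : ℝ} (hs : 0 < s) :
    ∃ Γ : Gadget b, Γ.q = Γ.p ∧ (∀ z z', Γ.g z z' ≤ 2 * s) ∧
      ∃ z z', iterCurveFlatDist Γ.g (b + 1) z z' < iterCurveFlatDist Γ.g b z z' := by
  have h0 : (0 : ℝ) ∈ Icc 0 s := ⟨le_rfl, hs.le⟩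
  have hss : s ∈ Icc 0 s := ⟨hs.le, le_rfl⟩
  have : Nonempty (Icc 0 s) := ⟨⟨0, h0⟩⟩
  obtain ⟨Z, ρ, ι, π, H⟩ := hb (Icc 0 s) s 1 hs one_pos fun x y => by
    rw [Subtype.dist_eq, Real.dist_eq, abs_le]
    constructor <;> linarith [x.2.1, x.2.2, y.2.1, y.2.2]
  have hex : ∃ c > 0, IsExact (Icc 0 s) c := ⟨1, one_pos, isExact_Icc 0 s 1⟩
  have h1 := H.pseudo.iter (b + 1)
  refine ⟨{
    G := Z
    g := ρ
    p := ι ⟨0, h0⟩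
    q := ι ⟨0, h0⟩
    far := ∅
    a := 1
    pseudo := H.pseudo
    compact := H.compact
    a_pos := one_pos
    gap := fun z hz z' hz' => hz'.elim
    p_notMem := notMem_empty _
    near := fun z hz => ?_
    far_q := fun z hz => hz.elim
    width := ?_
    jump := ?_ }, rfl, H.size, ι ⟨0, h0⟩, ι ⟨s, hss⟩, ?_⟩
  · have e := H.iter_add_one_segment hex subset_rfl (π z) ⟨0, h0⟩ (π z).2 h0
    have e' := (H.pseudo.iter_anti (Order.le_succ b) _ _).trans (H.total z).le
    rw [Order.succ_eq_add_one] at e'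
    refine le_antisymm ((h1.triangle _ (ι (π z)) _).trans ?_) (h1.nonneg _ _)
    linarith
  · rw [H.pseudo.self, (H.pseudo.iter b).self]
  · rw [h1.self]
    exact zero_le_one
  · have e := H.iter_add_one_segment hex subset_rfl ⟨0, h0⟩ ⟨s, hss⟩ h0 hss
    have e' := H.le_iter (ι ⟨0, h0⟩) (ι ⟨s, hss⟩)
    rw [H.left_inv, H.left_inv, Subtype.dist_eq, Real.dist_eq, zero_sub, abs_neg,
      abs_of_pos hs] at e'
    exact e.trans_lt (hs.trans_le e')

/-- The metric on a gadget at the stage `β`, or that of a two-point space after the collapse. -/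
noncomputable def Gadget.stage {b : Ordinal.{0}} (Γ : Gadget b) (β : Ordinal.{0}) (z w : Γ.G) : ℝ :=
  open Classical in
  if β ≤ b then iterCurveFlatDist Γ.g β z w else if (z ∈ Γ.far ↔ w ∈ Γ.far) then 0 else Γ.a

variable {b : Ordinal.{0}} (Γ : Gadget b)

theorem Gadget.stage_of_le {β : Ordinal.{0}} (h : β ≤ b) : Γ.stage β = iterCurveFlatDist Γ.g β := by
  funext z w
  rw [Gadget.stage, if_pos h]

theorem Gadget.isPseudoDist_stage (β : Ordinal.{0}) : IsPseudoDist (Γ.stage β) := by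
  classical
  by_cases h : β ≤ b
  · rw [Γ.stage_of_le h]
    exact Γ.pseudo.iter β
  · have hapos := Γ.a_pos.le
    refine ⟨fun x => ?_, fun x y => ?_, fun x y z => ?_⟩
    · simp [Gadget.stage, h]
    · simp only [Gadget.stage, h, if_false]
      simp only [iff_comm]
    · simp only [Gadget.stage, h, if_false]
      by_cases h1 : x ∈ Γ.far <;> by_cases h2 : y ∈ Γ.far <;> by_cases h3 : z ∈ Γ.far <;>
        simp [h1, h2, h3, hapos]

/-- By `gap`, near and far points are at least `a` apart at stage `b`, so passing to the two-point
metric only decreases distances. -/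
theorem Gadget.stage_le_iter {β δ : Ordinal.{0}} (hδ : δ ≤ b) (hβδ : δ ≤ β) (z w : Γ.G) :
    Γ.stage β z w ≤ iterCurveFlatDist Γ.g δ z w := by
  classical
  by_cases h : β ≤ b
  · rw [Γ.stage_of_le h]
    exact Γ.pseudo.iter_anti hβδ z w
  · refine le_trans ?_ (Γ.pseudo.iter_anti hδ z w)
    simp only [Gadget.stage, h, if_false]
    by_cases h1 : z ∈ Γ.far <;> by_cases h2 : w ∈ Γ.far
    · simpa [h1, h2] using (Γ.pseudo.iter b).nonneg z w
    · simpa [h1, h2, (Γ.pseudo.iter b).symm z w] using Γ.gap w h2 z h1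
    · simpa [h1, h2] using Γ.gap z h1 w h2
    · simpa [h1, h2] using (Γ.pseudo.iter b).nonneg z w

theorem Gadget.stage_anti {β δ : Ordinal.{0}} (hβδ : δ ≤ β) (z w : Γ.G) :
    Γ.stage β z w ≤ Γ.stage δ z w := by
  by_cases h : δ ≤ b
  · rw [Γ.stage_of_le h]
    exact Γ.stage_le_iter h hβδ z w
  · have h' : ¬ β ≤ b := fun h' => h (hβδ.trans h')
    simp only [Gadget.stage, h, h', if_false, le_refl]

/-- A function that is `1`-Lipschitz for `σ` takes at most two values. -/
theorem nullOver_of_two {X : Type u} {ρ σ : X → X → ℝ} (S : Set X)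
    (h : ∀ z w, (z ∈ S ↔ w ∈ S) → σ z w ≤ 0) : NullOver ρ σ := by
  intro K γ _ _ F hF
  have hF' : ∀ z w, (z ∈ S ↔ w ∈ S) → F z = F w := fun z w hzw =>
    sub_eq_zero.1 (abs_eq_zero.1 (le_antisymm ((hF z w).trans (h z w hzw)) (abs_nonneg _)))
  have h1 : (F '' S).Subsingleton := by
    rintro _ ⟨z, hz, rfl⟩ _ ⟨w, hw, rfl⟩
    exact hF' z w (by simp [hz, hw])
  have h2 : (F '' Sᶜ).Subsingleton := by
    rintro _ ⟨z, hz, rfl⟩ _ ⟨w, hw, rfl⟩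
    exact hF' z w (by rw [mem_compl_iff] at hz hw; simp [hz, hw])
  refine measure_mono_null (t := F '' S ∪ F '' Sᶜ) ?_
    (measure_union_null (h1.measure_zero _) (h2.measure_zero _))
  rw [← image_union, union_compl_self]
  rintro _ ⟨t, -, rfl⟩
  exact ⟨γ t, mem_univ _, rfl⟩

theorem Gadget.nullOver_stage (β : Ordinal.{0}) :
    NullOver (Γ.stage β) (Γ.stage (β + 1)) := by
  by_cases h : β + 1 ≤ b
  · rw [Γ.stage_of_le h, Γ.stage_of_le ((Order.le_succ β).trans h), iterCurveFlatDist_add_one]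
    exact (Γ.compact.mono (Γ.pseudo.iter β) (Γ.pseudo.iter_le β)).nullOver_curveFlatDist
      (Γ.pseudo.iter β)
  · refine nullOver_of_two Γ.far fun z w hzw => ?_
    simp [Gadget.stage, h, hzw]

end Gadget

/-! ### The glued space and its intermediate stages -/

section Assembly

variable {M : Type u} [MetricSpace M] {I : Type u} {b : I → Ordinal.{0}}

/-- Gadgets of orders `b i < α` can be glued to `M`, with the metric `snow c ∘ dist`, along the pairs
`P i`, `Q i`. -/
structure IsAssembly (α : Ordinal.{0}) (c : ℝ) (Γ : ∀ i, Gadget (b i)) (P Q : I → M) : Prop where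
  c_pos : 0 < c
  width_eq : ∀ i, (Γ i).g (Γ i).p (Γ i).q = snow c (dist (P i) (Q i))
  of_ne : ∀ i, P i ≠ Q i → (Γ i).a = dist (P i) (Q i) ∧ (Γ i).q ∈ (Γ i).far
  of_eq : ∀ i, P i = Q i → (Γ i).q = (Γ i).p
  lt : ∀ i, b i < α
  finite : ∀ β < α, {i | b i < β}.Finite

/-- The pseudometric of the space obtained from `M` by gluing gadgets. -/
noncomputable def assemblyDist (c : ℝ) (Γ : ∀ i, Gadget (b i)) (P Q : I → M) :
    M ⊕ (Σ i, (Γ i).G) → M ⊕ (Σ i, (Γ i).G) → ℝ :=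
  glueDist (fun x y => snow c (dist x y)) (fun i => (Γ i).g) P Q (fun i => (Γ i).p)
    fun i => (Γ i).q

open Classical in
/-- The projection of the glued space that collapses the gadgets. -/
noncomputable def assemblyProj (Γ : ∀ i, Gadget (b i)) (P Q : I → M) :
    M ⊕ (Σ i, (Γ i).G) → M
  | .inl x => x
  | .inr z => if z.2 ∈ (Γ z.1).far then Q z.1 else P z.1

/-- The scale below which `M` remains distorted at the stage `β`. -/
noncomputable def cutoff (c : ℝ) (Γ : ∀ i, Gadget (b i)) (β : Ordinal.{0}) : ℝ :=
  sInf (insert c ((fun i => (Γ i).a) '' {i | b i < β}))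

/-- A lower bound for the curve-flat pseudometric of order `β` of the glued space. -/
noncomputable def stageDist (c : ℝ) (Γ : ∀ i, Gadget (b i)) (P Q : I → M) (β : Ordinal.{0}) :
    M ⊕ (Σ i, (Γ i).G) → M ⊕ (Σ i, (Γ i).G) → ℝ :=
  glueDist (fun x y => snow (cutoff c Γ β) (dist x y)) (fun i => (Γ i).stage β) P Q
    (fun i => (Γ i).p) fun i => (Γ i).q

variable {α : Ordinal.{0}} {c : ℝ} {Γ : ∀ i, Gadget (b i)} {P Q : I → M}

theorem cutoff_zero : cutoff c Γ 0 = c := by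
  simp [cutoff]

theorem cutoff_nonneg (hc : 0 < c) (β : Ordinal.{0}) : 0 ≤ cutoff c Γ β :=
  Real.sInf_nonneg (by
    rintro _ (rfl | ⟨i, -, rfl⟩)
    exacts [hc.le, (Γ i).a_pos.le])

theorem bddBelow_cutoff (hc : 0 < c) (β : Ordinal.{0}) :
    BddBelow (insert c ((fun i => (Γ i).a) '' {i | b i < β})) :=
  ⟨0, by
    rintro _ (rfl | ⟨i, -, rfl⟩)
    exacts [hc.le, (Γ i).a_pos.le]⟩

theorem cutoff_le (hc : 0 < c) (β : Ordinal.{0}) : cutoff c Γ β ≤ c :=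
  csInf_le (bddBelow_cutoff hc β) (mem_insert _ _)

theorem cutoff_le_a (hc : 0 < c) {β : Ordinal.{0}} {i : I} (hi : b i < β) :
    cutoff c Γ β ≤ (Γ i).a :=
  csInf_le (bddBelow_cutoff hc β) (mem_insert_of_mem _ ⟨i, hi, rfl⟩)

theorem cutoff_anti (hc : 0 < c) {β δ : Ordinal.{0}} (h : δ ≤ β) :
    cutoff c Γ β ≤ cutoff c Γ δ :=
  csInf_le_csInf (bddBelow_cutoff hc β) (insert_nonempty _ _)
    (insert_subset_insert (image_mono fun _ hi => lt_of_lt_of_le hi h))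

namespace IsAssembly

/-- Only finitely many gadgets have order below `β`, so the infimum is attained by a positive
number. -/
theorem cutoff_pos (H : IsAssembly α c Γ P Q) {β : Ordinal.{0}} (hβ : β < α) :
    0 < cutoff c Γ β := by
  have hfin : (insert c ((fun i => (Γ i).a) '' {i | b i < β})).Finite :=
    ((H.finite β hβ).image _).insert c
  have := (insert_nonempty _ _).csInf_mem hfin
  rcases this with h | ⟨i, -, h⟩
  · rw [cutoff, h]
    exact H.c_pos
  · rw [cutoff, ← h]
    exact (Γ i).a_pos

theorem isGlueData (H : IsAssembly α c Γ P Q) :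
    IsGlueData (fun x y : M => snow c (dist x y)) (fun i => (Γ i).g) P Q (fun i => (Γ i).p)
      fun i => (Γ i).q :=
  ⟨isPseudoDist_snow H.c_pos.le, fun i => (Γ i).pseudo, fun i => (H.width_eq i).ge⟩

/-- Before its collapse a gadget keeps its full width up to stage `b i`. Afterwards its width is
`dist (P i) (Q i)`, which is at least the cutoff, so `snow` is the identity there. -/
theorem isGlueData_stage (H : IsAssembly α c Γ P Q) (β : Ordinal.{0}) :
    IsGlueData (fun x y : M => snow (cutoff c Γ β) (dist x y)) (fun i => (Γ i).stage β) P Q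
      (fun i => (Γ i).p) fun i => (Γ i).q := by
  have h0 := cutoff_nonneg (Γ := Γ) H.c_pos β
  refine ⟨isPseudoDist_snow h0, fun i => (Γ i).isPseudoDist_stage β, fun i => ?_⟩
  by_cases hβ : β ≤ b i
  · rw [(Γ i).stage_of_le hβ]
    refine (snow_mono H.c_pos.le dist_nonneg (cutoff_le H.c_pos β) le_rfl).trans ?_
    rw [← H.width_eq]
    exact (Γ i).width.trans ((Γ i).pseudo.iter_anti hβ _ _)
  · rcases eq_or_ne (P i) (Q i) with h | h
    · rw [h, dist_self, snow_zero]
      exact ((Γ i).isPseudoDist_stage β).nonneg _ _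
    · obtain ⟨h1, h2⟩ := H.of_ne i h
      simp only [Gadget.stage, hβ, if_false, (Γ i).p_notMem, h2, iff_true]
      rw [← h1, snow_eq h0 (cutoff_le_a H.c_pos (not_le.1 hβ))]

theorem stage_hpq (H : IsAssembly α c Γ P Q) (β : Ordinal.{0}) (i : I) :
    0 < snow (cutoff c Γ β) (dist (P i) (Q i)) ∨ (Γ i).q = (Γ i).p := by
  rcases eq_or_ne (P i) (Q i) with h | h
  · exact Or.inr (H.of_eq i h)
  · exact Or.inl ((dist_pos.2 h).trans_le (le_snow _ _))

variable [Nonempty M]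

theorem stageDist_anti (H : IsAssembly α c Γ P Q) {β δ : Ordinal.{0}} (h : δ ≤ β)
    (z w : M ⊕ (Σ i, (Γ i).G)) : stageDist c Γ P Q β z w ≤ stageDist c Γ P Q δ z w :=
  (H.isGlueData_stage β).mono
    (fun _ _ => snow_mono (cutoff_nonneg H.c_pos δ) dist_nonneg (cutoff_anti H.c_pos h) le_rfl)
    (fun i => (Γ i).stage_anti h) z w

/-- The projection is `1`-Lipschitz on each piece: `snow` dominates the distance, and a gadget
dominates its collapsed two-point state. -/
theorem dist_proj_le_stageDist (H : IsAssembly α c Γ P Q) (β : Ordinal.{0})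
    (z w : M ⊕ (Σ i, (Γ i).G)) :
    dist (assemblyProj Γ P Q z) (assemblyProj Γ P Q w) ≤ stageDist c Γ P Q β z w := by
  classical
  refine le_glueDist_of_isPseudoDist ((isPseudoDist_dist M).comp (assemblyProj Γ P Q))
    (fun x y => le_snow _ _) (fun i x y => ?_) (fun i => ?_) (fun i => ?_) z w
  · refine le_trans ?_ ((Γ i).stage_anti (le_max_left β (b i + 1)) x y)
    have hβ : ¬ max β (b i + 1) ≤ b i := fun h =>
      absurd ((le_max_right _ _).trans h) (not_le.2 (Order.lt_succ _))
    simp only [Gadget.stage, hβ, if_false, assemblyProj]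
    rcases eq_or_ne (P i) (Q i) with h | h
    · simp only [h, ite_self, dist_self]
      split_ifs
      exacts [le_rfl, (Γ i).a_pos.le]
    · have h1 := (H.of_ne i h).1
      by_cases hx : x ∈ (Γ i).far <;> by_cases hy : y ∈ (Γ i).far <;>
        simp [hx, hy, h1, dist_comm]
  · simp [assemblyProj, (Γ i).p_notMem]
  · rcases eq_or_ne (P i) (Q i) with h | h
    · simp [assemblyProj, h]
    · simp [assemblyProj, (H.of_ne i h).2]

theorem isPseudoDist (H : IsAssembly α c Γ P Q) : IsPseudoDist (assemblyDist c Γ P Q) :=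
  H.isGlueData.isPseudoDist

theorem iter_inr_le (H : IsAssembly α c Γ P Q) (i : I) (β : Ordinal.{0}) (x y : (Γ i).G) :
    iterCurveFlatDist (assemblyDist c Γ P Q) β (.inr ⟨i, x⟩) (.inr ⟨i, y⟩) ≤
      iterCurveFlatDist (Γ i).g β x y :=
  iterCurveFlatDist_map_le H.isPseudoDist (φ := fun x : (Γ i).G => .inr ⟨i, x⟩)
    (H.isGlueData.glueDist_inr_le i) β x y

theorem iter_inl_inr_p (H : IsAssembly α c Γ P Q) (i : I) (β : Ordinal.{0}) :
    iterCurveFlatDist (assemblyDist c Γ P Q) β (.inl (P i)) (.inr ⟨i, (Γ i).p⟩) ≤ 0 :=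
  (H.isPseudoDist.iter_le β _ _).trans (H.isGlueData.glueDist_inl_inr_p i)

theorem iter_inl_inr_q (H : IsAssembly α c Γ P Q) (i : I) (β : Ordinal.{0}) :
    iterCurveFlatDist (assemblyDist c Γ P Q) β (.inl (Q i)) (.inr ⟨i, (Γ i).q⟩) ≤ 0 :=
  (H.isPseudoDist.iter_le β _ _).trans (H.isGlueData.glueDist_inl_inr_q i)

theorem iter_pair_le (H : IsAssembly α c Γ P Q) (i : I) :
    iterCurveFlatDist (assemblyDist c Γ P Q) α (.inl (P i)) (.inl (Q i)) ≤ dist (P i) (Q i) := by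
  have hI := H.isPseudoDist.iter α
  rcases eq_or_ne (P i) (Q i) with h | h
  · rw [h, hI.self, dist_self]
  · have h1 := H.iter_inl_inr_p i α
    have h2 := H.iter_inl_inr_q i α
    rw [hI.symm] at h2
    have h3 := (H.isPseudoDist.iter_anti (Order.add_one_le_iff.2 (H.lt i)) _ _).trans
      ((H.iter_inr_le i (b i + 1) (Γ i).p (Γ i).q).trans (Γ i).jump)
    rw [(H.of_ne i h).1] at h3
    have h4 := hI.triangle (.inl (P i)) (.inr ⟨i, (Γ i).p⟩) (.inl (Q i))
    have h5 := hI.triangle (.inr ⟨i, (Γ i).p⟩) (.inr ⟨i, (Γ i).q⟩) (.inl (Q i))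
    linarith

theorem iter_proj (H : IsAssembly α c Γ P Q) (z : M ⊕ (Σ i, (Γ i).G)) :
    iterCurveFlatDist (assemblyDist c Γ P Q) α z (.inl (assemblyProj Γ P Q z)) = 0 := by
  classical
  have hI := H.isPseudoDist.iter α
  rcases z with x | ⟨i, z⟩
  · exact hI.self _
  refine le_antisymm ?_ (hI.nonneg _ _)
  have hle : ∀ x y : (Γ i).G, iterCurveFlatDist (assemblyDist c Γ P Q) α (.inr ⟨i, x⟩)
      (.inr ⟨i, y⟩) ≤ iterCurveFlatDist (Γ i).g (b i + 1) x y := fun x y =>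
    (H.isPseudoDist.iter_anti (Order.add_one_le_iff.2 (H.lt i)) _ _).trans (H.iter_inr_le i _ x y)
  by_cases hz : z ∈ (Γ i).far
  · simp only [assemblyProj, hz, if_true]
    have h1 := H.iter_inl_inr_q i α
    rw [hI.symm] at h1
    have h2 := hle z (Γ i).q
    rw [(Γ i).far_q z hz] at h2
    exact (hI.triangle _ (.inr ⟨i, (Γ i).q⟩) _).trans (by linarith)
  · simp only [assemblyProj, hz, if_false]
    have h1 := H.iter_inl_inr_p i α
    rw [hI.symm] at h1
    have h2 := hle z (Γ i).p
    rw [(Γ i).near z hz] at h2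
    exact (hI.triangle _ (.inr ⟨i, (Γ i).p⟩) _).trans (by linarith)

/-- A hair is a `1`-Lipschitz retract of the glued space, everything else being sent to its root,
and iterates respect `1`-Lipschitz maps. -/
theorem le_iter_inr (H : IsAssembly α c Γ P Q) {i : I} (hi : P i = Q i) (β : Ordinal.{0})
    (x y : (Γ i).G) : iterCurveFlatDist (Γ i).g β x y ≤
      iterCurveFlatDist (assemblyDist c Γ P Q) β (.inr ⟨i, x⟩) (.inr ⟨i, y⟩) := by
  classical
  set r : M ⊕ (Σ i, (Γ i).G) → (Γ i).G := fun z =>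
    Sum.elim (fun _ => (Γ i).p) (fun z => if e : z.1 = i then e ▸ z.2 else (Γ i).p) z with hr
  have hri : ∀ x : (Γ i).G, r (.inr ⟨i, x⟩) = x := fun x => by simp [hr]
  have hrj : ∀ j (x : (Γ j).G), j ≠ i → r (.inr ⟨j, x⟩) = (Γ i).p := fun j x hj => by
    simp [hr, hj]
  have hrp : ∀ j, r (.inr ⟨j, (Γ j).p⟩) = (Γ i).p := fun j => by
    rcases eq_or_ne j i with rfl | hj
    · exact hri _
    · exact hrj j _ hj
  have hrq : ∀ j, r (.inr ⟨j, (Γ j).q⟩) = (Γ i).p := fun j => by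
    rcases eq_or_ne j i with rfl | hj
    · rw [hri, H.of_eq j hi]
    · exact hrj j _ hj
  have hrM : ∀ x, r (.inl x) = (Γ i).p := fun x => rfl
  have hself := (Γ i).pseudo.self
  have hle : ∀ z w, (Γ i).g (r z) (r w) ≤ assemblyDist c Γ P Q z w := by
    refine le_glueDist_of_isPseudoDist ((Γ i).pseudo.comp r) (fun x y => ?_) (fun j x y => ?_)
      (fun j => ?_) (fun j => ?_)
    · rw [hrM, hrM, hself]
      exact dist_nonneg.trans (le_snow _ _)
    · rcases eq_or_ne j i with rfl | hj
      · rw [hri, hri]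
      · rw [hrj j x hj, hrj j y hj, hself]
        exact (Γ j).pseudo.nonneg _ _
    · rw [hrM, hrp, hself]
    · rw [hrM, hrq, hself]
  have := iterCurveFlatDist_map_le (Γ i).pseudo hle β (.inr ⟨i, x⟩) (.inr ⟨i, y⟩)
  rwa [hri, hri] at this

variable [CompactSpace M] [Countable I]

theorem nullOver_stageDist (H : IsAssembly α c Γ P Q) {β : Ordinal.{0}} (hβ : β < α) :
    NullOver (stageDist c Γ P Q β) (stageDist c Γ P Q (β + 1)) := by
  refine (H.isGlueData_stage β).nullOver ?_ (fun i => ?_) (H.stage_hpq β)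
  · refine (nullOver_snow (H.cutoff_pos hβ)).mono (fun _ _ => le_rfl) fun x y => ?_
    refine ((H.isGlueData_stage (β + 1)).glueDist_inl_le x y).trans ?_
    exact snow_mono (cutoff_nonneg H.c_pos β) dist_nonneg
      (cutoff_anti H.c_pos (Order.le_succ β)) le_rfl
  · exact ((Γ i).nullOver_stage β).mono (fun _ _ => le_rfl)
      fun x y => (H.isGlueData_stage (β + 1)).glueDist_inr_le i x y

/-- In the successor step, fragments for the iterate are also fragments for the smaller `stageDist`,
and `nullOver_stageDist` makes the next `stageDist` an admissible lower bound. -/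
theorem stageDist_le_iter (H : IsAssembly α c Γ P Q) {β : Ordinal.{0}} (hβ : β < α) :
    ∀ z w, stageDist c Γ P Q β z w ≤ iterCurveFlatDist (assemblyDist c Γ P Q) β z w := by
  induction β using Ordinal.limitRecOn with
  | zero =>
    intro z w
    rw [iterCurveFlatDist_zero]
    refine (H.isGlueData_stage 0).mono (fun x y => by rw [cutoff_zero]) (fun i a a' => ?_) z w
    rw [(Γ i).stage_of_le (zero_le (a := b i)), iterCurveFlatDist_zero]
  | add_one β ih =>
    have hlt : β < α := (Order.lt_succ β).trans hβ
    rw [iterCurveFlatDist_add_one]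
    have h1 := (H.nullOver_stageDist hlt).mono (ih hlt) fun _ _ => le_rfl
    exact h1.le_curveFlatDist (H.isGlueData_stage _).isPseudoDist fun z w =>
      (H.stageDist_anti (Order.le_succ β) z w).trans (ih hlt z w)
  | limit β hlim ih =>
    intro z w
    exact le_iterCurveFlatDist_limit hlim fun γ hγ =>
      (H.stageDist_anti hγ.le z w).trans (ih γ hγ (hγ.trans hβ) z w)

theorem nullOver_proj (H : IsAssembly α c Γ P Q) {β : Ordinal.{0}} (hβ : β < α) :
    NullOver (stageDist c Γ P Q β)
      fun z w => dist (assemblyProj Γ P Q z) (assemblyProj Γ P Q w) := by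
  refine (H.isGlueData_stage β).nullOver ?_ (fun i => ?_) (H.stage_hpq β)
  · exact (nullOver_snow (H.cutoff_pos hβ)).mono (fun _ _ => le_rfl) fun x y => le_snow _ _
  · refine nullOver_of_two (Γ i).far fun z w hzw => ?_
    by_cases hw : w ∈ (Γ i).far
    · simp [assemblyProj, hw, hzw.2 hw]
    · simp [assemblyProj, hw, mt hzw.1 hw]

/-- For `α = β + 1` the cutoff at `β` is still positive, so the distance of projections is null over
stage `β` and passes to the next one. For limit `α` the bound holds at all earlier stages. -/
theorem dist_proj_le_iter (H : IsAssembly α c Γ P Q) (hα : α ≠ 0) (z w : M ⊕ (Σ i, (Γ i).G)) :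
    dist (assemblyProj Γ P Q z) (assemblyProj Γ P Q w) ≤
      iterCurveFlatDist (assemblyDist c Γ P Q) α z w := by
  induction α using Ordinal.limitRecOn with
  | zero => exact (hα rfl).elim
  | add_one β _ =>
    have hlt : β < β + 1 := Order.lt_succ β
    rw [iterCurveFlatDist_add_one]
    have h1 := (H.nullOver_proj hlt).mono (H.stageDist_le_iter hlt) fun _ _ => le_rfl
    exact h1.le_curveFlatDist ((isPseudoDist_dist M).comp (assemblyProj Γ P Q)) (fun z w =>
      (H.dist_proj_le_stageDist β z w).trans (H.stageDist_le_iter hlt z w)) z w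
  | limit β hlim _ =>
    exact le_iterCurveFlatDist_limit hlim fun γ hγ =>
      (H.dist_proj_le_stageDist γ z w).trans (H.stageDist_le_iter hγ z w)

end IsAssembly

end Assembly

/-! ### The induction on `α` -/

section Construction

/-- Running maxima of an enumeration of the ordinals below `α`; they treat successors and limits
alike. -/
theorem exists_cofinal_levels {α : Ordinal.{0}} (hα : α.card ≤ Cardinal.aleph0) (h0 : α ≠ 0) :
    ∃ b : ℕ → Ordinal.{0}, (∀ k, b k < α) ∧ ∀ β < α, ∃ N, ∀ k ≥ N, β ≤ b k := by
  have hpos : 0 < α := pos_iff_ne_zero.2 h0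
  have hc : Countable (Iio α) := by
    rw [← Cardinal.mk_le_aleph0_iff, Cardinal.mk_Iio_ordinal]
    exact Cardinal.lift_le_aleph0.2 hα
  have hne : Nonempty (Iio α) := ⟨⟨0, hpos⟩⟩
  obtain ⟨e, he⟩ := exists_surjective_nat (Iio α)
  refine ⟨fun k => (Finset.range (k + 1)).sup fun i => (e i).1, fun k => ?_, fun β hβ => ?_⟩
  · exact (Finset.sup_lt_iff hpos).2 fun i _ => (e i).2
  · obtain ⟨N, hN⟩ := he ⟨β, hβ⟩
    refine ⟨N, fun k hk => ?_⟩
    have := Finset.le_sup (f := fun i => (e i).1) (Finset.mem_range.2 (Nat.lt_succ_of_le hk))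
    rwa [hN] at this

theorem exists_gadget_of_pair {M : Type u} [MetricSpace M] {b : Ordinal.{0}}
    (hb : Collapsible.{0} b) {c s : ℝ} (hs : 0 < s) (P Q : M)
    (hle : snow c (dist P Q) ≤ s) : ∃ Γ : Gadget b, Γ.g Γ.p Γ.q = snow c (dist P Q) ∧
      (∀ z z', Γ.g z z' ≤ 2 * s) ∧ (P ≠ Q → Γ.a = dist P Q ∧ Γ.q ∈ Γ.far) ∧
      (P = Q → Γ.q = Γ.p ∧
        ∃ z z', iterCurveFlatDist Γ.g (b + 1) z z' < iterCurveFlatDist Γ.g b z z') := by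
  rcases eq_or_ne P Q with rfl | h
  · obtain ⟨Γ, h1, h2, h3⟩ := exists_hair hb hs
    refine ⟨Γ, ?_, h2, fun h => (h rfl).elim, fun _ => ⟨h1, h3⟩⟩
    rw [h1, Γ.pseudo.self, dist_self, snow_zero]
  · obtain ⟨Γ, h1, h2, h3, h4⟩ := exists_gadget hb (dist_pos.2 h) (le_snow c (dist P Q))
    exact ⟨Γ, h1, fun z z' => (h4 z z').trans (by linarith), fun _ => ⟨h2, h3⟩,
      fun h' => (h h').elim⟩

/-- The gadgets are modelled on subsets of `ℝ`, so the induction hypothesis is needed only in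
universe `0`, whatever the universe of `M`. -/
theorem collapsible_of_forall_lt {α : Ordinal.{0}} (hα : α.card ≤ Cardinal.aleph0) (h0 : α ≠ 0)
    (ih : ∀ β < α, Collapsible.{0} β) : Collapsible.{u} α := by
  intro M _ _ _ A ε hA hε hMA
  obtain ⟨l, hlα, hl⟩ := exists_cofinal_levels hα h0
  -- Below `A / 10` the total size is at most `4 c + A + 4 c ≤ 2 A`, and pairs at distance `A` are
  -- undistorted. If `M` is exact at some positive scale, `c` is also taken below it.
  obtain ⟨c, hc, hcA, hcex⟩ : ∃ c > 0, c ≤ A / 10 ∧ ((∃ c > 0, IsExact M c) → IsExact M c) := by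
    by_cases hex : ∃ c > 0, IsExact M c
    · obtain ⟨c, hc, h⟩ := hex
      exact ⟨min c (A / 10), lt_min hc (by positivity), min_le_right _ _,
        fun _ => h.mono (min_le_left _ _)⟩
    · exact ⟨A / 10, by positivity, le_rfl, fun h => (hex h).elim⟩
  obtain ⟨T, hTfin, hTdiag, hTdist, hT⟩ := exists_pairs M hc hε
  let I : Type u := Σ k : ℕ, T k
  have hTc : ∀ k, Finite (T k) := fun k => (hTfin k).to_subtype
  have hIfin : ∀ N : ℕ, {i : I | i.1 < N}.Finite := fun N => by
    refine (finite_lt_nat N).preimage' (f := fun i : I => i.1) fun k _ => ?_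
    refine (finite_range fun t : T k => (⟨k, t⟩ : I)).subset ?_
    rintro ⟨k', t⟩ rfl
    exact ⟨t, rfl⟩
  let P : I → M := fun i => i.2.1.1
  let Q : I → M := fun i => i.2.1.2
  -- A bound for the widths of the gadgets of level `k`; it tends to zero, which makes the glued
  -- space compact.
  let s : ℕ → ℝ := fun k => snow c (2 * (c * (1 / 2) ^ k))
  have hspos : ∀ k, 0 < s k := fun k => lt_of_lt_of_le (by positivity) (le_snow _ _)
  have hs2c : ∀ k, s k ≤ 2 * c := fun k => by
    have : (1 / 2 : ℝ) ^ k ≤ 1 := pow_le_one₀ (by norm_num) (by norm_num)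
    exact snow_le hc.le (by positivity) (by linarith) (by nlinarith)
  have hslim : Filter.Tendsto s Filter.atTop (nhds 0) := by
    have h1 : Filter.Tendsto (fun k : ℕ => 2 * (c * (1 / 2 : ℝ) ^ k)) Filter.atTop (nhds 0) := by
      have := ((tendsto_pow_atTop_nhds_zero_of_lt_one (r := (1 / 2 : ℝ)) (by norm_num)
        (by norm_num)).const_mul c).const_mul 2
      simpa using this
    have h2 := ((continuous_snow c).tendsto 0).comp h1
    rwa [snow_zero] at h2
  have hgad := fun i : I => exists_gadget_of_pair (ih (l i.1) (hlα i.1)) (c := c) (hspos i.1)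
    (P i) (Q i) (snow_mono hc.le dist_nonneg le_rfl (hTdist i.1 _ i.2.2))
  choose Γ hΓw hΓs hΓne hΓeq using hgad
  have H : IsAssembly α c Γ P Q := ⟨hc, hΓw, hΓne, fun i hi => (hΓeq i hi).1, fun i => hlα i.1,
    fun β hβ => by
      obtain ⟨N, hN⟩ := hl β hβ
      exact (hIfin N).subset fun i hi => show i.1 < N from not_le.1 fun h => absurd hi (not_lt.2 (hN i.1 h))⟩
  have hpd := H.isPseudoDist
  have hσ : IsPseudoDist fun x y : M =>
      iterCurveFlatDist (assemblyDist c Γ P Q) α (.inl x) (.inl y) := (hpd.iter α).comp _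
  have hσsnow : ∀ x y : M, iterCurveFlatDist (assemblyDist c Γ P Q) α (.inl x) (.inl y) ≤
      snow c (dist x y) := fun x y => (hpd.iter_le α _ _).trans (H.isGlueData.glueDist_inl x y).le
  obtain ⟨hup, hloc⟩ := hT _ hσ hσsnow fun k p hp => H.iter_pair_le (⟨k, p, hp⟩ : I)
  refine ⟨M ⊕ (Σ i, (Γ i).G), assemblyDist c Γ P Q, .inl, assemblyProj Γ P Q, hpd, ?_, ?_,
    fun x => rfl, H.dist_proj_le_iter h0, H.iter_proj, hup, fun x y hxy => ?_, fun β hβ => ?_,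
    fun hex => ?_⟩
  · refine H.isGlueData.isSeqCompactDist (isSeqCompactDist_snow c) (fun i => (Γ i).compact)
      (r := fun i => 2 * s i.1) hΓs fun η hη => ?_
    obtain ⟨N, hN⟩ := Filter.eventually_atTop.1 (hslim.eventually (gt_mem_nhds (half_pos hη)))
    refine (hIfin N).subset fun i hi => show i.1 < N from not_le.1 fun h => ?_
    have h1 : η < 2 * s i.1 := hi
    linarith [hN i.1 h]
  · intro z w
    refine (H.isGlueData.glueDist_le_of_size (A := A) (r := 4 * c) (fun x y => ?_)
      (by positivity) (fun i a a' => ?_) z w).trans (by linarith)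
    · exact snow_le hc.le dist_nonneg (by linarith) (hMA x y)
    · linarith [hΓs i a a', hs2c i.1]
  · rw [show assemblyDist c Γ P Q (.inl x) (.inl y) = _ from H.isGlueData.glueDist_inl x y, hxy]
    exact snow_eq hc.le (by linarith)
  -- The diagonal pair of a level with `β ≤ l N` carries a hair, which shrinks between the stages `l
  -- N` and `l N + 1 ≤ α`.
  · obtain ⟨N, hN⟩ := hl β hβ
    obtain ⟨x, hx⟩ := hTdiag N
    let i : I := ⟨N, (x, x), hx⟩
    have hi : P i = Q i := rfl
    obtain ⟨z, w, hzw⟩ := (hΓeq i hi).2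
    refine ⟨.inr ⟨i, z⟩, .inr ⟨i, w⟩, ?_⟩
    calc iterCurveFlatDist (assemblyDist c Γ P Q) α (.inr ⟨i, z⟩) (.inr ⟨i, w⟩)
        ≤ iterCurveFlatDist (assemblyDist c Γ P Q) (l N + 1) (.inr ⟨i, z⟩) (.inr ⟨i, w⟩) :=
          hpd.iter_anti (Order.add_one_le_iff.2 (hlα N)) _ _
      _ ≤ iterCurveFlatDist (Γ i).g (l N + 1) z w := H.iter_inr_le i _ z w
      _ < iterCurveFlatDist (Γ i).g (l N) z w := hzw
      _ ≤ iterCurveFlatDist (assemblyDist c Γ P Q) (l N) (.inr ⟨i, z⟩) (.inr ⟨i, w⟩) :=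
          H.le_iter_inr hi _ z w
      _ ≤ iterCurveFlatDist (assemblyDist c Γ P Q) β (.inr ⟨i, z⟩) (.inr ⟨i, w⟩) :=
          hpd.iter_anti (hN N le_rfl) _ _
  · refine hcex hex _ hσ (fun x y hxy => (hσsnow x y).trans (snow_eq hc.le hxy).le) hloc

theorem collapsible {α : Ordinal.{0}} (hα : α.card ≤ Cardinal.aleph0) : Collapsible.{u} α := by
  have h : ∀ β : Ordinal.{0}, β.card ≤ Cardinal.aleph0 → Collapsible.{0} β := by
    intro β
    induction β using WellFoundedLT.induction with
    | _ β ih =>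
      intro hβ
      rcases eq_or_ne β 0 with rfl | h0
      · exact collapsible_zero
      · exact collapsible_of_forall_lt hβ h0 fun γ hγ =>
          ih γ hγ ((Ordinal.card_le_card hγ.le).trans hβ)
  rcases eq_or_ne α 0 with rfl | h0
  · exact collapsible_zero
  · exact collapsible_of_forall_lt hα h0 fun γ hγ => h γ ((Ordinal.card_le_card hγ.le).trans hα)

end Construction

/-! ### The index of the constructed space -/

section Quotient

/-- A pseudometric as a pseudometric space structure. -/
@[reducible]
def IsPseudoDist.toPseudoMetricSpace {Z : Type u} {ρ : Z → Z → ℝ} (h : IsPseudoDist ρ) :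
    PseudoMetricSpace Z where
  dist := ρ
  dist_self := h.self
  dist_comm := h.symm
  dist_triangle := h.triangle

/-- The index of a space with a curve-flat quotient bi-Lipschitz equivalent to `M`. -/
theorem isCurveFlatIndex_add {M Y : Type u} [MetricSpace M] [MetricSpace Y] {α κ : Ordinal.{0}}
    (hα : α.card ≤ Cardinal.aleph0) (hκ : IsCurveFlatIndex M κ) {ι : M → Y} {π : Y → M} {C : ℝ}
    (hC : 0 < C) (hπι : ∀ x, π (ι x) = x)
    (hle : ∀ y y', dist (π y) (π y') ≤ iterCurveFlatDist (dist : Y → Y → ℝ) α y y')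
    (htot : ∀ y, iterCurveFlatDist (dist : Y → Y → ℝ) α y (ι (π y)) = 0)
    (hup : ∀ x x', iterCurveFlatDist (dist : Y → Y → ℝ) α (ι x) (ι x') ≤ C * dist x x')
    (hstrict : ∀ β < α, ∃ y y', iterCurveFlatDist (dist : Y → Y → ℝ) α y y' <
      iterCurveFlatDist (dist : Y → Y → ℝ) β y y') : IsCurveFlatIndex Y (α + κ) := by
  have hY := isPseudoDist_dist Y
  have hM := isPseudoDist_dist M
  have h1 : ∀ β y y', iterCurveFlatDist (dist : M → M → ℝ) β (π y) (π y') ≤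
      iterCurveFlatDist (dist : Y → Y → ℝ) (α + β) y y' := fun β y y' => by
    rw [iterCurveFlatDist_add hY]
    exact iterCurveFlatDist_map_le hM hle β y y'
  have h2 : ∀ β x x', iterCurveFlatDist (dist : Y → Y → ℝ) (α + β) (ι x) (ι x') ≤
      C * iterCurveFlatDist (dist : M → M → ℝ) β x x' := fun β x x' => by
    rw [iterCurveFlatDist_add hY]
    exact iterCurveFlatDist_map_le_mul (hY.iter α) hC hup β x x'
  have h3 : ∀ β y y', iterCurveFlatDist (dist : Y → Y → ℝ) (α + β) y y' ≤
      C * iterCurveFlatDist (dist : M → M → ℝ) β (π y) (π y') := fun β y y' => by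
    have hI := hY.iter (α + β)
    have e : ∀ y, iterCurveFlatDist (dist : Y → Y → ℝ) (α + β) y (ι (π y)) ≤ 0 := fun y =>
      (hY.iter_anti le_self_add _ _).trans (htot y).le
    have e1 := hI.triangle y (ι (π y)) y'
    have e2 := hI.triangle (ι (π y)) (ι (π y')) y'
    rw [hI.symm (ι (π y')) y'] at e2
    linarith [e y, e y', h2 β (π y) (π y')]
  -- From stage `α` on, the iterates on `Y` and on `M` are bi-Lipschitz equivalent through `ι` and
  -- `π`.
  have hflat : ∀ β, IsFlat (iterCurveFlatDist (dist : Y → Y → ℝ) (α + β)) ↔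
      IsFlat (iterCurveFlatDist (dist : M → M → ℝ) β) := fun β => by
    refine ⟨fun h => h.of_map ι hC.le zero_le_one (h2 β) fun x x' => ?_,
      fun h => h.of_map π zero_le_one hC.le (fun y y' => ?_) (h3 β)⟩
    · have := h1 β (ι x) (ι x')
      rwa [hπι, hπι, ← one_mul (iterCurveFlatDist _ _ (ι x) (ι x'))] at this
    · rw [one_mul]
      exact h1 β y y'
  obtain ⟨⟨hκc, hκ1⟩, hκ2⟩ := hκ
  rw [isPurelyOneUnrectifiable_curveFlatQuotient_iff] at hκ1
  refine ⟨⟨?_, ?_⟩, ?_⟩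
  · rw [Ordinal.card_add]
    exact Cardinal.add_le_aleph0.2 ⟨hα, hκc⟩
  · rw [isPurelyOneUnrectifiable_curveFlatQuotient_iff, hflat]
    exact hκ1
  · rintro β ⟨hβc, hβ⟩
    rw [isPurelyOneUnrectifiable_curveFlatQuotient_iff] at hβ
    rcases lt_or_ge β α with hlt | hge
    -- Flatness at a stage `β < α` would freeze all later iterates, against the strict drop between
    -- `β` and `α`.
    · obtain ⟨y, y', hyy⟩ := hstrict β hlt
      have hst := hβ.curveFlatDist_eq (hY.iter β)
      have hall : ∀ δ, iterCurveFlatDist (iterCurveFlatDist (dist : Y → Y → ℝ) β) δ =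
          iterCurveFlatDist (dist : Y → Y → ℝ) β := fun δ => by
        induction δ using Ordinal.limitRecOn with
        | zero => rw [iterCurveFlatDist_zero]
        | add_one δ ih => rw [iterCurveFlatDist_add_one, ih, hst]
        | limit δ hδ ih =>
          funext x y
          refine le_antisymm ((hY.iter β).iter_le δ x y)
            (le_iterCurveFlatDist_limit hδ fun γ hγ => ?_)
          rw [ih γ hγ]
      obtain ⟨δ, rfl⟩ := exists_add_of_le hlt.le
      rw [iterCurveFlatDist_add hY, hall] at hyy
      exact absurd hyy (lt_irrefl _)
    · obtain ⟨δ, rfl⟩ := exists_add_of_le hge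
      rw [hflat] at hβ
      refine add_le_add_right (hκ2 ⟨?_, ?_⟩) α
      · exact (Ordinal.card_le_card le_add_self).trans hβc
      · rwa [isPurelyOneUnrectifiable_curveFlatQuotient_iff]

end Quotient

/-! ### Identification of points at distance zero, and conclusion -/

theorem theoremB (M : Type u) [MetricSpace M] [CompactSpace M] [Nontrivial M]
    (α : Ordinal.{0}) (hα : α.card ≤ Cardinal.aleph0) (ε : ℝ) (hε : 0 < ε) :
    ∃ κ : Ordinal.{0}, IsCurveFlatIndex M κ ∧
      ∃ (Y : Type u) (_ : MetricSpace Y) (_ : CompactSpace Y) (ι : M → Y),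
        IsCurveFlatIndex Y (α + κ) ∧
        Metric.diam (Set.univ : Set Y) < 3 * Metric.diam (Set.univ : Set M) ∧
        Function.Injective ι ∧
        (∀ y : Y, ∃ x : M, iterCurveFlatDist (dist : Y → Y → ℝ) α y (ι x) = 0) ∧
        (∀ x x' : M,
          dist x x' ≤ iterCurveFlatDist (dist : Y → Y → ℝ) α (ι x) (ι x') ∧
          iterCurveFlatDist (dist : Y → Y → ℝ) α (ι x) (ι x') ≤ (1 + ε) * dist x x') ∧
        IsAlmostIsometry ε
          (fun x : M => toCurveFlatQuotient Y α (ι x)) ∧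
        (∀ x x' : M, dist x x' = Metric.diam (Set.univ : Set M) →
          dist (ι x) (ι x') = dist x x') ∧
        (IsGeodesicSpace M ∨ IsGappedSegment M ∨ Finite M →
          ∀ x x' : M,
            iterCurveFlatDist (dist : Y → Y → ℝ) α (ι x) (ι x') = dist x x') := by
  obtain ⟨κ, hκ⟩ := exists_isCurveFlatIndex M
  refine ⟨κ, hκ, ?_⟩
  set A := Metric.diam (univ : Set M) with hA
  have hApos : 0 < A := Metric.diam_pos nontrivial_univ isCompact_univ.isBounded
  have hMA : ∀ x y : M, dist x y ≤ A := fun x y =>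
    Metric.dist_le_diam_of_mem isCompact_univ.isBounded (mem_univ x) (mem_univ y)
  obtain ⟨Z, ρ, ι, π, H⟩ := collapsible.{u} hα M A ε hApos hε hMA
  let _ : PseudoMetricSpace Z := H.pseudo.toPseudoMetricSpace
  let mk : Z → SeparationQuotient Z := SeparationQuotient.mk
  obtain ⟨out, hout⟩ := (SeparationQuotient.surjective_mk (X := Z)).hasRightInverse
  have hdmk : ∀ z w, dist (mk z) (mk w) = ρ z w := fun z w => SeparationQuotient.dist_mk z w
  have hdout : ∀ y y', ρ (out y) (out y') = dist y y' := fun y y' => by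
    rw [← hdmk, show mk (out y) = y from hout y, show mk (out y') = y' from hout y']
  have hYd := isPseudoDist_dist (SeparationQuotient Z)
  have hmk : ∀ β z w, iterCurveFlatDist (dist : SeparationQuotient Z → _ → ℝ) β (mk z) (mk w) ≤
      iterCurveFlatDist ρ β z w := fun β =>
    iterCurveFlatDist_map_le hYd (fun z w => (hdmk z w).le) β
  have hiout : ∀ β y y', iterCurveFlatDist ρ β (out y) (out y') =
      iterCurveFlatDist (dist : SeparationQuotient Z → _ → ℝ) β y y' := fun β y y' => by
    refine le_antisymm (iterCurveFlatDist_map_le H.pseudo (fun y y' => (hdout y y').le) β y y') ?_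
    have := hmk β (out y) (out y')
    rwa [show mk (out y) = y from hout y, show mk (out y') = y' from hout y'] at this
  have hrho0 : ∀ z, ρ (out (mk z)) z = 0 := fun z => by
    rw [← hdmk, show mk (out (mk z)) = mk z from hout (mk z), dist_self]
  -- The quotient map and its section both preserve distances, and a point is at distance zero from
  -- the chosen representative of its class, so all iterates agree.
  have himk : ∀ β z w, iterCurveFlatDist (dist : SeparationQuotient Z → _ → ℝ) β (mk z) (mk w) =
      iterCurveFlatDist ρ β z w := fun β z w => by
    refine le_antisymm (hmk β z w) ?_
    have hI := H.pseudo.iter β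
    have e : ∀ z, iterCurveFlatDist ρ β (out (mk z)) z ≤ 0 := fun z =>
      (H.pseudo.iter_le β _ _).trans (hrho0 z).le
    have e1 := hI.triangle z (out (mk z)) w
    have e2 := hI.triangle (out (mk z)) (out (mk w)) w
    rw [hI.symm z (out (mk z))] at e1
    linarith [e z, e w, hiout β (mk z) (mk w)]
  have hcompact : CompactSpace (SeparationQuotient Z) := by
    have : IsSeqCompact (univ : Set Z) := fun x _ => by
      obtain ⟨a, φ, hφ, ha⟩ := H.compact x
      exact ⟨a, mem_univ a, φ, hφ, tendsto_iff_dist_tendsto_zero.2 ha⟩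
    have : CompactSpace Z := ⟨this.isCompact⟩
    exact Quotient.compactSpace
  have hle : ∀ y y', dist (π (out y)) (π (out y')) ≤
      iterCurveFlatDist (dist : SeparationQuotient Z → _ → ℝ) α y y' := fun y y' => by
    rw [← hiout]; exact H.le_iter _ _
  have hlow : ∀ x x', dist x x' ≤
      iterCurveFlatDist (dist : SeparationQuotient Z → _ → ℝ) α (mk (ι x)) (mk (ι x')) :=
    fun x x' => by
      rw [himk]
      have := H.le_iter (ι x) (ι x')
      rwa [H.left_inv, H.left_inv] at this
  have hup : ∀ x x', iterCurveFlatDist (dist : SeparationQuotient Z → _ → ℝ) α (mk (ι x))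
      (mk (ι x')) ≤ (1 + ε) * dist x x' := fun x x' => by
    rw [himk]; exact H.iter_le x x'
  have hinj : Function.Injective fun x => mk (ι x) := fun x x' h => by
    have h1 := hlow x x'
    simp only at h
    rw [h, (hYd.iter α).self] at h1
    exact dist_le_zero.1 h1
  have htot : ∀ y, iterCurveFlatDist (dist : SeparationQuotient Z → _ → ℝ) α y
      (mk (ι (π (out y)))) = 0 := fun y => by
    have := H.total (out y)
    rwa [← himk, show mk (out y) = y from hout y] at this
  -- The section may pick a representative other than `ι x`, but at distance zero from it, and `π`
  -- does not increase distances.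
  have hπι : ∀ x, π (out (mk (ι x))) = x := fun x => by
    have h1 := H.le_iter (out (mk (ι x))) (ι x)
    rw [H.left_inv] at h1
    exact dist_le_zero.1 (h1.trans ((H.pseudo.iter_le α _ _).trans (hrho0 _).le))
  refine ⟨SeparationQuotient Z, inferInstance, hcompact, fun x => mk (ι x), ?_, ?_, hinj,
    fun y => ⟨_, htot y⟩, fun x x' => ⟨hlow x x', hup x x'⟩, ⟨⟨?_, ?_⟩, ?_⟩, ?_, ?_⟩
  · refine isCurveFlatIndex_add (π := fun y => π (out y)) hα hκ (by linarith : 0 < 1 + ε) hπι hle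
      htot hup fun β hβ => ?_
    obtain ⟨z, w, hzw⟩ := H.strict β hβ
    exact ⟨mk z, mk w, by rwa [himk, himk]⟩
  · refine lt_of_le_of_lt (Metric.diam_le_of_forall_dist_le (C := 2 * A) (by positivity)
      fun y _ y' _ => ?_) (by linarith)
    rw [← hdout]
    exact H.size _ _
  · intro x x' h
    have h1 : dist (toCurveFlatQuotient (SeparationQuotient Z) α (mk (ι x)))
        (toCurveFlatQuotient (SeparationQuotient Z) α (mk (ι x'))) =
        iterCurveFlatDist (dist : SeparationQuotient Z → _ → ℝ) α (mk (ι x)) (mk (ι x')) :=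
      SeparationQuotient.dist_mk _ _
    rw [show toCurveFlatQuotient (SeparationQuotient Z) α (mk (ι x)) = _ from h, dist_self] at h1
    exact dist_le_zero.1 ((hlow x x').trans h1.ge)
  · intro y
    obtain ⟨y, rfl⟩ := SeparationQuotient.surjective_mk y
    refine ⟨π (out y), SeparationQuotient.mk_eq_mk.2 (Metric.inseparable_iff.2 ?_)⟩
    exact ((hYd.iter α).symm _ _).trans (htot y)
  · intro x x'
    have h1 : dist (toCurveFlatQuotient (SeparationQuotient Z) α (mk (ι x)))
        (toCurveFlatQuotient (SeparationQuotient Z) α (mk (ι x'))) =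
        iterCurveFlatDist (dist : SeparationQuotient Z → _ → ℝ) α (mk (ι x)) (mk (ι x')) :=
      SeparationQuotient.dist_mk _ _
    simp only
    rw [h1]
    refine ⟨le_trans ?_ (hlow x x'), hup x x'⟩
    nlinarith [dist_nonneg (x := x) (y := x')]
  · intro x x' h
    simp only
    rw [hdmk, H.eq_of_diam x x' h, h]
  · intro h x x'
    refine le_antisymm ?_ (hlow x x')
    rw [himk]
    refine H.exact ?_ x x'
    rcases h with h | h | h
    · exact ⟨1, one_pos, h.isExact 1⟩
    · exact h.exists_isExact
    · exact Finite.exists_isExact
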